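/- Consider a star network with $N$ local agents and one fusion agent (agent $0$), and a hypothesis $H\in\{0,1\}$ with $\mathbb P[H=0]=\pi_0\in(0,1)$. Given $H=h$, the private signals $Y_0,\dots,Y_N$ of the agents are i.i.d. real random variables with density $f(\cdot|h)$; the laws $P_0,P_1$ with densities $f(\cdot|0),f(\cdot|1)$ are distinct and mutually absolutely continuous. Local agent $i$ sends a decision $\hat H_i\in\{0,1\}$ based on $Y_i$ to the fusion agent, which makes a decision $\hat H_0\in\{0,1\}$ based on $Y_0,\hat H_1,\dots,\hat H_N$. With costs $c_{FA},c_{MD}>0$ the risk of the fusion agent is $$R_0^{(N)}=c_{FA}\,\pi_0\,\mathbb P[\hat H_0=1|H=0]+c_{MD}(1-\pi_0)\,\mathbb P[\hat H_0=0|H=1].$$ Let $\beta^*(\pi_0)=\sup\limsup_{N\to\infty}\bigl(-\tfrac1N\log R_0^{(N)}\bigr)$, the supremum being over all sequences of decision rules of all agents (jointly chosen for each $N$, local rules not necessarily identical, independent randomization allowed). Let $\gamma^*(\pi_0)$ be the analogous supremum for the error probability $\pi_0\mathbb P[\hat H_0=1|H=0]+(1-\pi_0)\mathbb P[\hat H_0=0|H=1]$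 in the cooperative network, where the fusion agent sees only $\hat H_1,\dots,\hat H_N$ and has no private signal. The likelihood ratio test (LRT) with belief $q$ decides $1$ if $f(y|1)/f(y|0)>\lambda(q)=\frac{c_{FA}\,q}{c_{MD}(1-q)}$ and $0$ if $f(y|1)/f(y|0)<\lambda(q)$; ties are resolved by a convention, the same for all agents: at a tie decide $1$ exactly when $y\in T$, where $T\subseteq\mathbb R$ is measurable. Let $p_q(d|h)$ be the probability, given $H=h$, that this test decides $d$ from one private signal. If the agents hold beliefs $q_0,q_1,\dots,q_N\in(0,1)$, local agent $i$ applies the LRT with belief $q_i$ to $Y_i$; the fusion agent, which interprets the local decisions $\hat h_1,\dots,\hat h_N$ as made with its own belief $q_0$, applies to $Y_0$ the LRT with the updated belief $q_0'$ given by $$\frac{q_0'}{1-q_0'}=\frac{q_0}{1-q_0}\prod_{i=1}^N\frac{p_{q_0}(\hat h_i|0)}{p_{q_0}(\hat h_i|1)}.$$ For distributions $p_1,p_2$ on $\{0,1\}$ let $C(p_1,p_2)=-\min_{s\in[0,1]}\log\sum_x p_1(x)^s p_2(x)^{1-s}$ be the Chernoff information. **Theorem.** Suppose that the private signals are sub-Gaussian: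 there is $\sigma^2\ge 0$ such that $\mathbb E_h[e^{s(Y-\mathbb E_h Y)}]\le e^{\sigma^2s^2/2}$ for all $s\in\mathbb R$ and $h\in\{0,1\}$. Then for some tie convention $T$, and for every tie convention $T$ if ties have probability zero (that is, $P_h(f(Y|1)/f(Y|0)=\lambda)=0$ for all $\lambda>0$ and $h\in\{0,1\}$), the following holds. There is a belief $q^*\in(0,1)$, not depending on $\pi_0$, such that for every $\pi_0\in(0,1)$ the LRTs with belief update and identical beliefs $q_0=q_1=\dots=q_N=q^*$ satisfy $$\lim_{N\to\infty}-\tfrac1N\log R_0^{(N)}=\beta^*(\pi_0)=\gamma^*(\pi_0)=\max_{q_1\in(0,1)}C\bigl(\mathrm{Bern}(p_{q_1}(1|0)),\mathrm{Bern}(p_{q_1}(1|1))\bigr),$$ where the maximum is attained and is the same for all $\pi_0$. -/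

import Mathlib

open MeasureTheory ProbabilityTheory Set Filter Topology
open scoped NNReal ENNReal

noncomputable section

/-- The observation model of the star network. Hypotheses and decisions are encoded by `Bool`,
with `false` for `0` and `true` for `1`; `f h` is the conditional density of each agent's private
signal given `H = h`. The two conditional laws are distinct and mutually absolutely continuous. -/
structure StarModel where
  f : Bool → ℝ → ℝ
  measurable_f : ∀ h, Measurable (f h)
  nonneg_f : ∀ h y, 0 ≤ f h y
  lintegral_f : ∀ h, ∫⁻ y, ENNReal.ofReal (f h y) = 1
  ac : ∀ h h', (volume.withDensity fun y => ENNReal.ofReal (f h y)) ≪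
    volume.withDensity fun y => ENNReal.ofReal (f h' y)
  ne : (volume.withDensity fun y => ENNReal.ofReal (f false y)) ≠
    volume.withDensity fun y => ENNReal.ofReal (f true y)

/-- A (possibly randomized) binary test on `α`: `φ x` is the probability of deciding `1` after
observing `x`. Deterministic rules are the tests with values in `{0, 1}`. -/
def IsTest {α : Type*} [MeasurableSpace α] (φ : α → ℝ) : Prop :=
  Measurable φ ∧ ∀ x, φ x ∈ Icc (0 : ℝ) 1

/-- A way to resolve ties in a likelihood ratio test: on equality, decide `1` exactly when the
private signal lies in the given measurable set. -/
abbrev TieRule := {T : Set ℝ // MeasurableSet T}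

/-- Decision rules of all agents in the star network with `N` local agents: each local agent sees
its own private signal, the fusion agent sees all local decisions and its own private signal. -/
structure DecisionRules (N : ℕ) where
  localRule : Fin N → ℝ → ℝ
  fusionRule : (Fin N → Bool) → ℝ → ℝ
  isTest_local : ∀ i, IsTest (localRule i)
  isTest_fusion : ∀ d, IsTest (fusionRule d)

/-- Decision rules in the cooperative star network, in which the fusion agent has no private
signal and only sees the `N` local decisions. -/
structure CooperativeRules (N : ℕ) where
  localRule : Fin N → ℝ → ℝ
  fusionRule : (Fin N → Bool) → ℝ
  isTest_local : ∀ i, IsTest (localRule i)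
  fusion_mem : ∀ d, fusionRule d ∈ Icc (0 : ℝ) 1

/-- The mass function of the Bernoulli distribution with success probability `t`. -/
def bern (t : ℝ) : Bool → ℝ := fun b => if b then t else 1 - t

/-- Chernoff information between two probability mass functions (with common support). -/
def chernoffInfo {X : Type*} [Fintype X] (p₁ p₂ : X → ℝ) : ℝ :=
  -⨅ s : Icc (0 : ℝ) 1, Real.log (∑ x, p₁ x ^ (s : ℝ) * p₂ x ^ (1 - (s : ℝ)))

/-- The initial threshold `λ(q)` of a likelihood ratio test with belief `q`. -/
def lrtThreshold (cFA cMD q : ℝ) : ℝ := cFA * q / (cMD * (1 - q))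

/-- The quantity whose limit is the exponent of the sequence of risks `R`. -/
def exponentAt (R : ℕ → ℝ) (N : ℕ) : ℝ := -(1 / (N : ℝ)) * Real.log (R N)

/-- The exponent of a sequence of risks, as an upper limit, so that it is defined for every
sequence; it agrees with the limit whenever that exists. -/
def riskExponent (R : ℕ → ℝ) : EReal := limsup (fun N => (exponentAt R N : EReal)) atTop

namespace StarModel

variable (M : StarModel)

/-- The conditional law of a private signal given `H = h`. -/
def P (h : Bool) : Measure ℝ := volume.withDensity fun y => ENNReal.ofReal (M.f h y)

instance (h : Bool) : IsProbabilityMeasure (M.P h) :=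
  ⟨by rw [P, withDensity_apply _ MeasurableSet.univ, Measure.restrict_univ, M.lintegral_f]⟩

/-- The private observations are sub-Gaussian: the centred signal has a sub-Gaussian moment
generating function under either hypothesis, with a common variance proxy. -/
def SubGaussian : Prop :=
  ∃ σ2 : ℝ≥0, ∀ h, HasSubgaussianMGF (fun y => y - ∫ z, z ∂(M.P h)) σ2 (M.P h)

/-- The likelihood ratio of a private signal (the set `{f false = 0}` is null for both laws). -/
def LR (y : ℝ) : ℝ := M.f true y / M.f false y

lemma measurable_LR : Measurable M.LR := (M.measurable_f true).div (M.measurable_f false)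

/-- Ties in likelihood ratio tests with positive threshold have probability zero. -/
def TiesNull : Prop := ∀ h, ∀ l : ℝ, 0 < l → M.P h {y | M.LR y = l} = 0

/-- The conditional probability, given `H = h`, that an agent using the test `φ` decides `d`. -/
def decisionProb (φ : ℝ → ℝ) (d h : Bool) : ℝ :=
  if d then ∫ y, φ y ∂(M.P h) else ∫ y, (1 - φ y) ∂(M.P h)

/-- The probability, given `H = h`, that the fusion agent decides `d`: the signals are
conditionally independent given `H`. -/
def fusionProb {N : ℕ} (S : DecisionRules N) (d h : Bool) : ℝ :=
  ∑ e : Fin N → Bool, (∏ i, M.decisionProb (S.localRule i) (e i) h) *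
    M.decisionProb (S.fusionRule e) d h

/-- The true Bayes risk `R₀` of the fusion agent; `π₀` is the prior probability of `H = 0`. -/
def risk (cFA cMD π₀ : ℝ) {N : ℕ} (S : DecisionRules N) : ℝ :=
  cFA * π₀ * M.fusionProb S true false + cMD * (1 - π₀) * M.fusionProb S false true

/-- The probability, given `H = h`, that the fusion agent of the cooperative network decides
`d`. -/
def cooperativeProb {N : ℕ} (S : CooperativeRules N) (d h : Bool) : ℝ :=
  ∑ e : Fin N → Bool, (∏ i, M.decisionProb (S.localRule i) (e i) h) *
    bern (S.fusionRule e) d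

/-- The error probability of the cooperative network. -/
def cooperativeError (π₀ : ℝ) {N : ℕ} (S : CooperativeRules N) : ℝ :=
  π₀ * M.cooperativeProb S true false + (1 - π₀) * M.cooperativeProb S false true

/-- The optimal risk exponent `β*` of the fusion agent: the supremum over all (sequences of)
decision rules, for local agents and fusion agent jointly, strategic ones included. -/
def optimalExponent (cFA cMD π₀ : ℝ) : EReal :=
  ⨆ S : (N : ℕ) → DecisionRules N, riskExponent fun N => M.risk cFA cMD π₀ (S N)

/-- The optimal error exponent of cooperative distributed detection. -/
def cooperativeExponent (π₀ : ℝ) : EReal :=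
  ⨆ S : (N : ℕ) → CooperativeRules N, riskExponent fun N => M.cooperativeError π₀ (S N)

/-- The likelihood ratio test with threshold `l`, ties being resolved by `T`. -/
def lrt (T : TieRule) (l : ℝ) : ℝ → ℝ :=
  ({y | l < M.LR y} ∪ {y | M.LR y = l} ∩ T.1).indicator 1

lemma isTest_lrt (T : TieRule) (l : ℝ) : IsTest (M.lrt T l) := by
  refine ⟨?_, fun y => ?_⟩
  · refine measurable_one.indicator ?_
    exact (measurableSet_lt measurable_const M.measurable_LR).union
      ((M.measurable_LR (measurableSet_singleton l)).inter T.2)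
  · unfold lrt
    by_cases hy : y ∈ {y | l < M.LR y} ∪ {y | M.LR y = l} ∩ T.1
    · rw [indicator_of_mem hy]; simp
    · rw [indicator_of_notMem hy]; simp

/-- The test which an agent with belief `q` applies to its private signal. -/
def beliefTest (T : TieRule) (cFA cMD q : ℝ) : ℝ → ℝ := M.lrt T (lrtThreshold cFA cMD q)

/-- `p(d | h)` for a local agent with belief `q`. -/
def localProb (T : TieRule) (cFA cMD q : ℝ) (d h : Bool) : ℝ :=
  M.decisionProb (M.beliefTest T cFA cMD q) d h

/-- The odds `q₀' / (1 - q₀')` of the fusion agent after seeing the local decisions `e`. It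
computes the probabilities of local decisions as if every local agent had the belief `q₀`. (A
factor `0 / 0` belongs to a decision which is impossible for an agent with belief `q₀`.) -/
def updatedOdds (T : TieRule) (cFA cMD q₀ : ℝ) {N : ℕ} (e : Fin N → Bool) : ℝ :=
  q₀ / (1 - q₀) *
    ∏ i, M.localProb T cFA cMD q₀ (e i) false / M.localProb T cFA cMD q₀ (e i) true

/-- The updated belief `q₀'` of the fusion agent, which has the odds `updatedOdds`. -/
def updatedBelief (T : TieRule) (cFA cMD q₀ : ℝ) {N : ℕ} (e : Fin N → Bool) : ℝ :=
  M.updatedOdds T cFA cMD q₀ e / (1 + M.updatedOdds T cFA cMD q₀ e)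

lemma decisionProb_nonneg {φ : ℝ → ℝ} (hφ : IsTest φ) (d h : Bool) :
    0 ≤ M.decisionProb φ d h := by
  unfold decisionProb
  split_ifs
  · exact integral_nonneg fun y => (hφ.2 y).1
  · exact integral_nonneg fun y => sub_nonneg.2 (hφ.2 y).2

/-- The updated belief satisfies the belief update equation. -/
lemma updatedBelief_odds (T : TieRule) (cFA cMD : ℝ) {q₀ : ℝ} (hq : q₀ ∈ Ioo (0 : ℝ) 1) {N : ℕ}
    (e : Fin N → Bool) :
    M.updatedBelief T cFA cMD q₀ e / (1 - M.updatedBelief T cFA cMD q₀ e) =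
      q₀ / (1 - q₀) *
        ∏ i, M.localProb T cFA cMD q₀ (e i) false / M.localProb T cFA cMD q₀ (e i) true := by
  have h0 : 0 ≤ M.updatedOdds T cFA cMD q₀ e :=
    mul_nonneg (div_nonneg hq.1.le (sub_nonneg.2 hq.2.le)) (Finset.prod_nonneg fun i _ =>
      div_nonneg (M.decisionProb_nonneg (M.isTest_lrt T _) _ _)
        (M.decisionProb_nonneg (M.isTest_lrt T _) _ _))
  have h1 : 1 + M.updatedOdds T cFA cMD q₀ e ≠ 0 := by positivity
  change _ = M.updatedOdds T cFA cMD q₀ e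
  unfold updatedBelief
  field_simp
  ring

/-- The selfish decision rules for beliefs `q₀` (fusion agent) and `q i` (local agents): every
local agent performs the likelihood ratio test with its own belief, and the fusion agent performs
the likelihood ratio test on its private signal with its updated belief. -/
def beliefRules (T : TieRule) (cFA cMD q₀ : ℝ) {N : ℕ} (q : Fin N → ℝ) : DecisionRules N where
  localRule i := M.beliefTest T cFA cMD (q i)
  fusionRule e := M.beliefTest T cFA cMD (M.updatedBelief T cFA cMD q₀ e)
  isTest_local _ := M.isTest_lrt T _
  isTest_fusion _ := M.isTest_lrt T _

end StarModel

end

/-! Let `K` be the set of pairs (probability of deciding 1 under `H = 0`, the same under `H = 1`)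
over all randomized tests of one private signal, and let `ζ` be the infimum over `K` and `s ∈ [0,
1]` of the affinity of the two Bernoulli laws. Every exponent in the theorem equals `-log ζ`.

Attainment. Mutual absolute continuity is uniform over tests, so affinities cannot drop far below
`1` for `s` near `0` or `1`; hence `ζ` is attained on the closure of `K` at an interior `s`. There
the affinity lies below its tangent plane, so any point of `K` minimizing a suitable functional `l *
p - q` has affinity at most `ζ` (`exists_slope_min`). By Neyman-Pearson (`lrt_optimal`) the
likelihood ratio test with threshold `l` is such a point, whatever its ties, and `l` is the
threshold of some belief `q*`. Priors play no role in this choice.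

Converse. For arbitrary local tests, the sum over decision vectors of the smaller of the two
likelihoods (`overlap`) is at least `c (ζ e^{-ε})^N` (`exists_le_sum_min`): tilt the product law by
the one `s` that centres the log-likelihood ratio. The normalizer is a product of affinities, hence
at least `ζ^N`, and the log-likelihood ratio has variance `O(N)`. A private signal at the fusion
agent gains only a constant factor, since its two conditional errors never sum to less than some `κ
> 0`.

Achievability. If all agents hold `q*`, the fusion threshold after seeing likelihoods `a`, `b` is `l
* (a / b)`, and Markov's inequality for the likelihood ratio bounds each error contribution by a
constant times `min a b` (`risk_beliefRules_le`). The risk is thus at most a constant times the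
overlap, which Chernoff's bound estimates by `ζ^N`. In the cooperative network, maximum likelihood
fusion does the same. -/

/-! ### Affinities of Bernoulli laws. -/

/-- The affinity `∑ x, p x ^ s * q x ^ (1 - s)` of the Bernoulli distributions with success
probabilities `p` and `q`. -/
noncomputable def affinity (s p q : ℝ) : ℝ :=
  p ^ s * q ^ (1 - s) + (1 - p) ^ s * (1 - q) ^ (1 - s)

lemma affinity_compl (s p q : ℝ) : affinity s (1 - p) (1 - q) = affinity s p q := by
  simp only [affinity, sub_sub_cancel]; ring

lemma affinity_swap (s p q : ℝ) : affinity (1 - s) q p = affinity s p q := by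
  simp only [affinity, sub_sub_cancel]; ring

lemma affinity_eq_sum_bern (s p q : ℝ) :
    ∑ x, bern p x ^ s * bern q x ^ (1 - s) = affinity s p q := by
  simp [bern, affinity]

lemma affinity_self {s p : ℝ} (hp : p ∈ Icc (0 : ℝ) 1) : affinity s p p = 1 := by
  have key : ∀ x : ℝ, 0 ≤ x → x ^ s * x ^ (1 - s) = x := fun x hx => by
    rw [← Real.rpow_add' hx (by simp)]; simp
  rw [affinity, key p hp.1, key (1 - p) (by linarith [hp.2])]; ring

/-- Weighted arithmetic-geometric mean inequality: a tangent plane dominates `x ^ s * y ^ (1 - s)`. -/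
lemma rpow_mul_rpow_le_tangent {s t x y : ℝ} (hs : s ∈ Icc (0 : ℝ) 1) (ht : 0 < t) (hx : 0 ≤ x)
    (hy : 0 ≤ y) :
    x ^ s * y ^ (1 - s) ≤ s * (t ^ (1 - s) * x) + (1 - s) * (t ^ (-s) * y) := by
  have h := Real.geom_mean_le_arith_mean2_weighted hs.1 (sub_nonneg.2 hs.2)
    (mul_nonneg (Real.rpow_nonneg ht.le (1 - s)) hx) (mul_nonneg (Real.rpow_nonneg ht.le (-s)) hy)
    (by ring)
  refine le_of_eq_of_le ?_ h
  rw [Real.mul_rpow (by positivity) hx, Real.mul_rpow (by positivity) hy, ← Real.rpow_mul ht.le,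
    ← Real.rpow_mul ht.le, mul_mul_mul_comm, ← Real.rpow_add ht]
  simp [mul_comm]

lemma rpow_mul_rpow_eq_tangent {s x y : ℝ} (hx : 0 < x) (hy : 0 < y) :
    x ^ s * y ^ (1 - s) =
      s * ((y / x) ^ (1 - s) * x) + (1 - s) * ((y / x) ^ (-s) * y) := by
  have h1 : (y / x) ^ (1 - s) * x = x ^ s * y ^ (1 - s) := by
    rw [Real.div_rpow hy.le hx.le, Real.rpow_sub hx, Real.rpow_one]
    field_simp
  have h2 : (y / x) ^ (-s) * y = x ^ s * y ^ (1 - s) := by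
    rw [Real.div_rpow hy.le hx.le, Real.rpow_neg hy.le, Real.rpow_neg hx.le, Real.rpow_sub hy,
      Real.rpow_one]
    field_simp
  rw [h1, h2]; ring

/-- A linear functional whose decrease does not increase the affinity. -/
lemma exists_slope_affinity_le {s p q : ℝ} (hs : s ∈ Ioo (0 : ℝ) 1) (hp : 0 < p) (hpq : p < q)
    (hq : q < 1) :
    ∃ l : ℝ, 0 < l ∧ ∀ p' ∈ Icc (0 : ℝ) 1, ∀ q' ∈ Icc (0 : ℝ) 1,
      l * p' - q' ≤ l * p - q → affinity s p' q' ≤ affinity s p q := by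
  -- `t₁` and `t₀` are the slopes at which the tangent planes of the two summands touch at `(p, q)`.
  -- Added up, they give `A * p' - B * q'` plus a constant; `p < q` makes both `A` and `B` positive.
  set t₁ := q / p
  set t₀ := (1 - q) / (1 - p)
  have ht₁ : 1 < t₁ := (one_lt_div hp).2 hpq
  have ht₀ : 0 < t₀ := div_pos (by linarith) (by linarith)
  have ht₀' : t₀ < 1 := (div_lt_one (by linarith)).2 (by linarith)
  have ht : t₀ < t₁ := ht₀'.trans ht₁
  have hA : 0 < s * (t₁ ^ (1 - s) - t₀ ^ (1 - s)) :=
    mul_pos hs.1 (sub_pos.2 (Real.rpow_lt_rpow ht₀.le ht (by linarith [hs.2])))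
  have hB : 0 < (1 - s) * (t₀ ^ (-s) - t₁ ^ (-s)) :=
    mul_pos (by linarith [hs.2])
      (sub_pos.2 (Real.rpow_lt_rpow_of_neg ht₀ ht (by linarith [hs.1])))
  set A := s * (t₁ ^ (1 - s) - t₀ ^ (1 - s)) with hAdef
  set B := (1 - s) * (t₀ ^ (-s) - t₁ ^ (-s)) with hBdef
  refine ⟨A / B, div_pos hA hB, fun p' hp' q' hq' hle => ?_⟩
  have hs' : s ∈ Icc (0 : ℝ) 1 := Ioo_subset_Icc_self hs
  have h1 := rpow_mul_rpow_le_tangent hs' (t := t₁) (by linarith) hp'.1 hq'.1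
  have h2 := rpow_mul_rpow_le_tangent hs' ht₀ (sub_nonneg.2 hp'.2) (sub_nonneg.2 hq'.2)
  have h3 := rpow_mul_rpow_eq_tangent (s := s) hp (hp.trans hpq)
  have h4 := rpow_mul_rpow_eq_tangent (s := s) (x := 1 - p) (y := 1 - q) (by linarith)
    (by linarith)
  have h5 : A * p' - B * q' ≤ A * p - B * q := by
    have := mul_le_mul_of_nonneg_left hle hB.le
    have e : B * (A / B) = A := by field_simp
    calc A * p' - B * q' = B * (A / B * p' - q') := by rw [mul_sub, ← mul_assoc, e]
      _ ≤ _ := this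
      _ = _ := by rw [mul_sub, ← mul_assoc, e]
  unfold affinity
  rw [h3, h4]
  refine (add_le_add h1 h2).trans ?_
  rw [hAdef, hBdef] at h5
  linear_combination h5

/-- Twice the gap to `1` is the squared Hellinger distance `(√p - √q)² + (√(1-p) - √(1-q))²`. -/
lemma affinity_half_lt_one {p q : ℝ} (hp : p ∈ Icc (0 : ℝ) 1) (hq : q ∈ Icc (0 : ℝ) 1)
    (hpq : p ≠ q) : affinity (1 / 2) p q < 1 := by
  have e : (1 : ℝ) - 1 / 2 = 1 / 2 := by norm_num
  unfold affinity
  rw [e]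
  simp only [← Real.sqrt_eq_rpow]
  have hp' : 0 ≤ 1 - p := sub_nonneg.2 hp.2
  have hq' : 0 ≤ 1 - q := sub_nonneg.2 hq.2
  have h1 := Real.sq_sqrt hp.1
  have h2 := Real.sq_sqrt hq.1
  have h3 := Real.sq_sqrt hp'
  have h4 := Real.sq_sqrt hq'
  have h5 : √p ≠ √q := fun h => hpq (by rw [← h1, ← h2, h])
  have h6 : 0 < (√p - √q) ^ 2 := by
    have := sub_ne_zero.2 h5
    positivity
  nlinarith [sq_nonneg (√(1 - p) - √(1 - q))]

/-- As `η ≤ 1 / 2`, at most one of `p` and `1 - p` is below `η`. If one is, the other outcome has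
mass at least `1 - ε` under the second law and its term suffices; if neither is, the two terms add
up to at least `η ^ s`. -/
lemma affinity_ge_of_small {ε η s p q : ℝ} (hε : ε ∈ Icc (0 : ℝ) 1) (hη : 0 < η) (hη' : η ≤ 1 / 2)
    (hs : s ∈ Icc (0 : ℝ) 1) (hp : p ∈ Icc (0 : ℝ) 1) (hq : q ∈ Icc (0 : ℝ) 1)
    (h1 : p < η → q ≤ ε) (h2 : 1 - p < η → 1 - q ≤ ε) :
    (1 - ε) * η ^ s ≤ affinity s p q := by
  have key : ∀ x y : ℝ, η ≤ x → y ∈ Icc (0 : ℝ) 1 → y * η ^ s ≤ x ^ s * y ^ (1 - s) := by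
    intro x y hx hy
    have a := Real.rpow_le_rpow hη.le hx hs.1
    have b : y ≤ y ^ (1 - s) := by
      simpa using Real.rpow_le_rpow_of_exponent_ge' hy.1 hy.2 (sub_nonneg.2 hs.2)
        (by linarith [hs.1] : 1 - s ≤ 1)
    rw [mul_comm]
    exact mul_le_mul a b hy.1 (a.trans' (by positivity))
  have hq' : 1 - q ∈ Icc (0 : ℝ) 1 := ⟨sub_nonneg.2 hq.2, by linarith [hq.1]⟩
  have hηs : 0 < η ^ s := by positivity
  have n1 : 0 ≤ p ^ s * q ^ (1 - s) :=
    mul_nonneg (Real.rpow_nonneg hp.1 _) (Real.rpow_nonneg hq.1 _)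
  have n2 : 0 ≤ (1 - p) ^ s * (1 - q) ^ (1 - s) :=
    mul_nonneg (Real.rpow_nonneg (sub_nonneg.2 hp.2) _) (Real.rpow_nonneg hq'.1 _)
  unfold affinity
  rcases lt_or_ge p η with h | h
  · have := key (1 - p) (1 - q) (by linarith) hq'
    nlinarith [h1 h]
  · have a := key p q h hq
    rcases lt_or_ge (1 - p) η with h' | h'
    · nlinarith [h2 h']
    · have := key (1 - p) (1 - q) h' hq'
      nlinarith [hε.1]

/-! ### The region of achievable pairs and its least affinity. -/

/-- Properties of the set of pairs of error probabilities that the tests between two mutually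
absolutely continuous distributions achieve. -/
structure IsTestRegion (K : Set (ℝ × ℝ)) : Prop where
  mem_Icc : ∀ x ∈ K, x.1 ∈ Icc (0 : ℝ) 1 ∧ x.2 ∈ Icc (0 : ℝ) 1
  compl_mem : ∀ x ∈ K, (1 - x.1, 1 - x.2) ∈ K
  uniform_ac : ∀ ε > 0, ∃ η > 0, ∀ x ∈ K, (x.1 < η → x.2 ≤ ε) ∧ (x.2 < η → x.1 ≤ ε)

namespace IsTestRegion

variable {K : Set (ℝ × ℝ)}

/-- The closure supplies the compactness for `exists_affinity_min`. The properties survive because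
the implications, read as disjunctions of weak inequalities, are closed conditions. -/
lemma closure (hK : IsTestRegion K) : IsTestRegion (closure K) where
  mem_Icc x hx := by
    have : _root_.closure K ⊆ Icc (0 : ℝ) 1 ×ˢ Icc (0 : ℝ) 1 :=
      closure_minimal (fun x hx => hK.mem_Icc x hx) (isClosed_Icc.prod isClosed_Icc)
    exact this hx
  compl_mem x hx := by
    have hc : Continuous fun x : ℝ × ℝ => (1 - x.1, 1 - x.2) := by fun_prop
    exact map_mem_closure (f := fun x : ℝ × ℝ => (1 - x.1, 1 - x.2)) hc hx hK.compl_mem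
  uniform_ac ε hε := by
    obtain ⟨η, hη, h⟩ := hK.uniform_ac ε hε
    refine ⟨η, hη, fun x hx => ?_⟩
    have : _root_.closure K ⊆ ({x | η ≤ x.1} ∪ {x | x.2 ≤ ε}) ∩ ({x | η ≤ x.2} ∪ {x | x.1 ≤ ε}) :=
      closure_minimal (fun y hy => ⟨(le_or_gt η y.1).imp id (h y hy).1,
        (le_or_gt η y.2).imp id (h y hy).2⟩)
        (((isClosed_le continuous_const continuous_fst).union
          (isClosed_le continuous_snd continuous_const)).inter
        ((isClosed_le continuous_const continuous_snd).union
          (isClosed_le continuous_fst continuous_const)))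
    obtain ⟨h1, h2⟩ := this hx
    exact ⟨fun h => h1.resolve_left (not_le.2 h), fun h => h2.resolve_left (not_le.2 h)⟩

lemma snd_eq_zero (hK : IsTestRegion K) {x : ℝ × ℝ} (hx : x ∈ K) (h : x.1 = 0) : x.2 = 0 := by
  refine le_antisymm (le_of_forall_pos_le_add fun ε hε => ?_) (hK.mem_Icc x hx).2.1
  obtain ⟨η, hη, H⟩ := hK.uniform_ac ε hε
  simpa using (H x hx).1 (h ▸ hη)

lemma fst_eq_zero (hK : IsTestRegion K) {x : ℝ × ℝ} (hx : x ∈ K) (h : x.2 = 0) : x.1 = 0 := by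
  refine le_antisymm (le_of_forall_pos_le_add fun ε hε => ?_) (hK.mem_Icc x hx).1.1
  obtain ⟨η, hη, H⟩ := hK.uniform_ac ε hε
  simpa using (H x hx).2 (h ▸ hη)

/-- By absolute continuity the region meets the boundary of the unit square only at `(0, 0)` and
`(1, 1)`. -/
lemma mem_Ioo_of_ne (hK : IsTestRegion K) {x : ℝ × ℝ} (hx : x ∈ K) (h : x.1 ≠ x.2) :
    x.1 ∈ Ioo (0 : ℝ) 1 ∧ x.2 ∈ Ioo (0 : ℝ) 1 := by
  have hI := hK.mem_Icc x hx
  have hc := hK.compl_mem x hx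
  have a1 : x.1 ≠ 0 := fun e => h (by rw [e, hK.snd_eq_zero hx e])
  have a2 : x.2 ≠ 0 := fun e => h (by rw [e, hK.fst_eq_zero hx e])
  have a3 : x.1 ≠ 1 := fun e => h (by
    have : 1 - x.2 = 0 := hK.snd_eq_zero hc (by simp [e])
    linarith)
  have a4 : x.2 ≠ 1 := fun e => h (by
    have : 1 - x.1 = 0 := hK.fst_eq_zero hc (by simp [e])
    linarith)
  exact ⟨⟨lt_of_le_of_ne hI.1.1 a1.symm, lt_of_le_of_ne hI.1.2 a3⟩,
    ⟨lt_of_le_of_ne hI.2.1 a2.symm, lt_of_le_of_ne hI.2.2 a4⟩⟩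

/-- The affinities of all pairs are close to `1` when the exponent is close to `0` or `1`. -/
lemma exists_affinity_ge (hK : IsTestRegion K) {r : ℝ} (hr : r < 1) :
    ∃ δ ∈ Ioo (0 : ℝ) (1 / 2), ∀ x ∈ K, ∀ s ∈ Icc (0 : ℝ) 1, s ≤ δ ∨ 1 - δ ≤ s →
      r ≤ affinity s x.1 x.2 := by
  wlog hr0 : 0 < r generalizing r
  · obtain ⟨δ, h, H⟩ := this (r := 1 / 2) (by norm_num) (by norm_num)
    exact ⟨δ, h, fun x hx s hs hsd => (H x hx s hs hsd).trans' (by linarith)⟩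
  set ε := (1 - r) / 2 with hε
  have hε0 : 0 < ε := by rw [hε]; linarith
  have hε1 : ε < 1 := by rw [hε]; linarith
  have hrε : r < 1 - ε := by rw [hε]; linarith
  obtain ⟨η₀, hη₀, H₀⟩ := hK.uniform_ac ε hε0
  set η := min η₀ (1 / 2) with hη
  have hηpos : 0 < η := lt_min hη₀ (by norm_num)
  have hηle : η ≤ 1 / 2 := min_le_right _ _
  have H : ∀ x ∈ K, (x.1 < η → x.2 ≤ ε) ∧ (x.2 < η → x.1 ≤ ε) := fun x hx =>
    ⟨fun h => (H₀ x hx).1 (h.trans_le (min_le_left _ _)),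
      fun h => (H₀ x hx).2 (h.trans_le (min_le_left _ _))⟩
  -- The lower bound of `affinity_ge_of_small` tends to `1 - ε > r` as `s → 0`; exponents near `1`
  -- follow by swapping the two laws.
  have hlim : Tendsto (fun s : ℝ => (1 - ε) * η ^ s) (𝓝[>] 0) (𝓝 ((1 - ε) * η ^ (0 : ℝ))) :=
    ((Real.continuous_const_rpow hηpos.ne').tendsto 0 |>.const_mul _).mono_left
      nhdsWithin_le_nhds
  rw [Real.rpow_zero, mul_one] at hlim
  obtain ⟨δ, hδr, hδ⟩ := ((hlim.eventually (lt_mem_nhds hrε)).and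
    (Ioo_mem_nhdsGT (show (0 : ℝ) < 1 / 2 by norm_num))).exists
  have hmono : ∀ s, s ≤ δ → r ≤ (1 - ε) * η ^ s := fun s hs =>
    hδr.le.trans (mul_le_mul_of_nonneg_left
      (Real.rpow_le_rpow_of_exponent_ge hηpos (by linarith) hs) (by linarith))
  refine ⟨δ, hδ, fun x hx s hs hsd => ?_⟩
  have hI := hK.mem_Icc x hx
  have hεI : ε ∈ Icc (0 : ℝ) 1 := ⟨hε0.le, hε1.le⟩
  have Hc := H _ (hK.compl_mem x hx)
  rcases hsd with h | h
  · exact (hmono s h).trans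
      (affinity_ge_of_small hεI hηpos hηle hs hI.1 hI.2 (H x hx).1 Hc.1)
  · rw [← affinity_swap]
    exact (hmono (1 - s) (by linarith)).trans
      (affinity_ge_of_small hεI hηpos hηle ⟨by linarith [hs.2], by linarith [hs.1]⟩ hI.2 hI.1
        (H x hx).2 Hc.2)

lemma exists_affinity_ge_pos (hK : IsTestRegion K) :
    ∃ κ > 0, ∀ x ∈ K, ∀ s ∈ Icc (0 : ℝ) 1, κ ≤ affinity s x.1 x.2 := by
  obtain ⟨η₀, hη₀, H₀⟩ := hK.uniform_ac (1 / 2) (by norm_num)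
  set η := min η₀ (1 / 2) with hη
  have hηpos : 0 < η := lt_min hη₀ (by norm_num)
  have hηle : η ≤ 1 / 2 := min_le_right _ _
  refine ⟨(1 - 1 / 2) * η ^ (1 : ℝ), by positivity, fun x hx s hs => ?_⟩
  have hI := hK.mem_Icc x hx
  have := affinity_ge_of_small (ε := 1 / 2) ⟨by norm_num, by norm_num⟩ hηpos hηle hs hI.1 hI.2
    (fun h => (H₀ x hx).1 (h.trans_le (min_le_left _ _)))
    (fun h => (H₀ _ (hK.compl_mem x hx)).1 (h.trans_le (min_le_left _ _)))
  refine this.trans' (mul_le_mul_of_nonneg_left ?_ (by norm_num))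
  exact Real.rpow_le_rpow_of_exponent_ge hηpos (by linarith) hs.2

lemma affinity_pos (hK : IsTestRegion K) {x : ℝ × ℝ} (hx : x ∈ K) {s : ℝ}
    (hs : s ∈ Icc (0 : ℝ) 1) : 0 < affinity s x.1 x.2 := by
  obtain ⟨κ, hκ, H⟩ := hK.exists_affinity_ge_pos
  exact hκ.trans_le (H x hx s hs)

/-- The least affinity over the closure of the region is attained at an interior exponent. -/
lemma exists_affinity_min (hK : IsTestRegion K) {x₀ : ℝ × ℝ} (hx₀ : x₀ ∈ K)
    (hne : x₀.1 ≠ x₀.2) :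
    ∃ x ∈ _root_.closure K, ∃ s ∈ Ioo (0 : ℝ) 1, affinity s x.1 x.2 < 1 ∧
      ∀ y ∈ K, ∀ t ∈ Icc (0 : ℝ) 1, affinity s x.1 x.2 ≤ affinity t y.1 y.2 := by
  have hI₀ := hK.mem_Icc x₀ hx₀
  have hlt := affinity_half_lt_one hI₀.1 hI₀.2 hne
  obtain ⟨δ, hδ, H⟩ := hK.exists_affinity_ge hlt
  have hcomp : IsCompact (_root_.closure K ×ˢ Icc δ (1 - δ)) := by
    refine IsCompact.prod ?_ isCompact_Icc
    refine (isCompact_Icc.prod isCompact_Icc : IsCompact (Icc (0 : ℝ) 1 ×ˢ Icc (0 : ℝ) 1))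
      |>.of_isClosed_subset isClosed_closure fun x hx => hK.closure.mem_Icc x hx
  have hhalf : (1 / 2 : ℝ) ∈ Icc δ (1 - δ) := ⟨hδ.2.le, by linarith [hδ.2]⟩
  have hcont : ContinuousOn (fun z : (ℝ × ℝ) × ℝ => affinity z.2 z.1.1 z.1.2)
      (_root_.closure K ×ˢ Icc δ (1 - δ)) := by
    intro z hz
    -- Real powers are jointly continuous at base `0` only for positive exponents, so `s` must stay
    -- away from both ends.
    have h1 : 0 < z.2 := hδ.1.trans_le hz.2.1
    have h2 : 0 < 1 - z.2 := by linarith [hδ.1, hz.2.2]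
    refine ContinuousAt.continuousWithinAt ?_
    unfold affinity
    refine ContinuousAt.add (ContinuousAt.mul ?_ ?_) (ContinuousAt.mul ?_ ?_)
    · exact ContinuousAt.rpow (by fun_prop) (by fun_prop) (Or.inr h1)
    · exact ContinuousAt.rpow (by fun_prop) (by fun_prop) (Or.inr h2)
    · exact ContinuousAt.rpow (by fun_prop) (by fun_prop) (Or.inr h1)
    · exact ContinuousAt.rpow (by fun_prop) (by fun_prop) (Or.inr h2)
  obtain ⟨⟨x, s⟩, hxs, hmin⟩ := hcomp.exists_isMinOn
    ⟨(x₀, 1 / 2), subset_closure hx₀, hhalf⟩ hcont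
  have hle₀ : affinity s x.1 x.2 ≤ affinity (1 / 2) x₀.1 x₀.2 :=
    hmin (show ((x₀, 1 / 2) : (ℝ × ℝ) × ℝ) ∈ _ from ⟨subset_closure hx₀, hhalf⟩)
  refine ⟨x, hxs.1, s, ⟨hδ.1.trans_le hxs.2.1, by linarith [hδ.1, hxs.2.2]⟩, hle₀.trans_lt hlt,
    fun y hy t ht => ?_⟩
  rcases le_or_gt t δ with h | h
  · exact hle₀.trans (H y hy t ht (Or.inl h))
  rcases le_or_gt (1 - δ) t with h' | h'
  · exact hle₀.trans (H y hy t ht (Or.inr h'))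
  · exact hmin (show ((y, t) : (ℝ × ℝ) × ℝ) ∈ _ from ⟨subset_closure hy, h.le, h'.le⟩)

/-- The least affinity over the region is attained by every pair that minimizes a suitable linear
functional. -/
lemma exists_slope_min (hK : IsTestRegion K) {x₀ : ℝ × ℝ} (hx₀ : x₀ ∈ K) (hne : x₀.1 ≠ x₀.2) :
    ∃ ζ ∈ Ioo (0 : ℝ) 1, ∃ s ∈ Ioo (0 : ℝ) 1,
      (∀ y ∈ K, ∀ t ∈ Icc (0 : ℝ) 1, ζ ≤ affinity t y.1 y.2) ∧
      ∃ l > 0, ∀ z ∈ K, (∀ y ∈ K, l * z.1 - z.2 ≤ l * y.1 - y.2) → affinity s z.1 z.2 ≤ ζ := by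
  obtain ⟨x, hx, s, hs, hlt, hmin⟩ := hK.exists_affinity_min hx₀ hne
  refine ⟨affinity s x.1 x.2, ⟨hK.closure.affinity_pos hx (Ioo_subset_Icc_self hs), hlt⟩, s, hs,
    hmin, ?_⟩
  clear hmin
  -- Renaming the decisions `0` and `1` reflects the region and preserves affinities.
  wlog hxx : x.1 < x.2 generalizing x
  · have hne' : x.1 ≠ x.2 := fun h => by
      rw [← h, affinity_self (hK.closure.mem_Icc x hx).1] at hlt
      exact lt_irrefl _ hlt
    have hgt : x.2 < x.1 := lt_of_le_of_ne (not_lt.1 hxx) hne'.symm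
    have := this (1 - x.1, 1 - x.2) (hK.closure.compl_mem x hx)
      (by simpa only [affinity_compl] using hlt) (by simpa using hgt)
    simpa only [affinity_compl] using this
  obtain ⟨h1, h2⟩ := hK.closure.mem_Ioo_of_ne hx hxx.ne
  obtain ⟨l, hl, H⟩ := exists_slope_affinity_le hs h1.1 hxx h2.2
  refine ⟨l, hl, fun z hz hzmin => ?_⟩
  have hI := hK.mem_Icc z hz
  refine H _ hI.1 _ hI.2 ?_
  -- `x` need not lie in `K`, but a linear bound over `K` extends to its closure.
  have : _root_.closure K ⊆ {y : ℝ × ℝ | l * z.1 - z.2 ≤ l * y.1 - y.2} :=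
    closure_minimal hzmin (isClosed_le continuous_const (by fun_prop))
  exact this hx

end IsTestRegion

/-! ### Exponential tilting and lower bounds for `∑ min(P, Q)`, where `P = Q * exp L`. -/

section Tilting

variable {X : Type*} [Fintype X] {Q L : X → ℝ}

/-- Rolle's theorem for the moment generating function, which is `1` at `s = 0` and `s = 1`. -/
lemma exists_tilt_mean_zero (hQ : ∑ x, Q x = 1) (hP : ∑ x, Q x * Real.exp (L x) = 1) :
    ∃ s ∈ Ioo (0 : ℝ) 1, ∑ x, Q x * Real.exp (s * L x) * L x = 0 := by
  have hd : ∀ s : ℝ, HasDerivAt (fun s : ℝ => ∑ x, Q x * Real.exp (s * L x))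
      (∑ x, Q x * Real.exp (s * L x) * L x) s := fun s => by
    refine HasDerivAt.fun_sum fun x _ => ?_
    have := (((hasDerivAt_id s).mul_const (L x)).exp).const_mul (Q x)
    simpa [mul_assoc] using this
  obtain ⟨s, hs, h⟩ := exists_hasDerivAt_eq_zero (zero_lt_one' ℝ)
    (fun s _ => (hd s).continuousAt.continuousWithinAt) (by simp [hQ, hP]) fun s _ => hd s
  exact ⟨s, hs, h⟩

/-- A critical point of the convex moment generating function is a global minimum. -/
lemma sum_tilt_le_of_mean_zero (hQ : ∀ x, 0 ≤ Q x) {s : ℝ}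
    (hs : ∑ x, Q x * Real.exp (s * L x) * L x = 0) (t : ℝ) :
    ∑ x, Q x * Real.exp (s * L x) ≤ ∑ x, Q x * Real.exp (t * L x) := by
  have h : ∀ x, Q x * Real.exp (s * L x) + (t - s) * (Q x * Real.exp (s * L x) * L x) ≤
      Q x * Real.exp (t * L x) := fun x => by
    have e : Real.exp (t * L x) = Real.exp (s * L x) * Real.exp ((t - s) * L x) := by
      rw [← Real.exp_add]; ring_nf
    have := mul_le_mul_of_nonneg_left (Real.add_one_le_exp ((t - s) * L x))
      (mul_nonneg (hQ x) (Real.exp_pos (s * L x)).le)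
    rw [e, ← mul_assoc]
    linarith
  have := Finset.sum_le_sum fun x (_ : x ∈ Finset.univ) => h x
  rwa [Finset.sum_add_distrib, ← Finset.mul_sum, hs, mul_zero, add_zero] at this

/-- Cauchy-Schwarz for `PQ = min(P, Q) * max(P, Q)`, with `∑ max(P, Q) ≤ 2`. It needs no variance
bound, but costs a square. -/
lemma half_sq_sum_tilt_le_sum_min (hQ0 : ∀ x, 0 ≤ Q x) (hQ : ∑ x, Q x = 1)
    (hP : ∑ x, Q x * Real.exp (L x) = 1) :
    (∑ x, Q x * Real.exp (1 / 2 * L x)) ^ 2 / 2 ≤ ∑ x, min (Q x * Real.exp (L x)) (Q x) := by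
  have hP0 : ∀ x, 0 ≤ Q x * Real.exp (L x) := fun x => mul_nonneg (hQ0 x) (Real.exp_pos _).le
  have hCS := Finset.sum_sq_le_sum_mul_sum_of_sq_le_mul Finset.univ
    (r := fun x => Q x * Real.exp (1 / 2 * L x))
    (f := fun x => min (Q x * Real.exp (L x)) (Q x))
    (g := fun x => max (Q x * Real.exp (L x)) (Q x))
    (fun x _ => le_min (hP0 x) (hQ0 x)) (fun x _ => (hQ0 x).trans (le_max_right _ _))
    (fun x _ => le_of_eq <| by
      rw [min_mul_max, mul_pow, ← Real.exp_nat_mul]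
      push_cast
      rw [show (2 : ℝ) * (1 / 2 * L x) = L x by ring]
      ring)
  have hmax : ∑ x, max (Q x * Real.exp (L x)) (Q x) ≤ 2 := by
    calc _ ≤ ∑ x, (Q x * Real.exp (L x) + Q x) := Finset.sum_le_sum fun x _ =>
          max_le (by linarith [hQ0 x]) (by linarith [hP0 x])
      _ = 2 := by rw [Finset.sum_add_distrib, hQ, hP]; norm_num
  have hmin : 0 ≤ ∑ x, min (Q x * Real.exp (L x)) (Q x) :=
    Finset.sum_nonneg fun x _ => le_min (hP0 x) (hQ0 x)
  nlinarith

/-- Change of measure to a tilted distribution under which the log-likelihood ratio is centred. -/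
lemma sum_tilt_mul_exp_le_sum_min (hQ : ∀ x, 0 ≤ Q x) {s τ V : ℝ} (hτ : 0 < τ)
    (hs : ∑ x, Q x * Real.exp (s * L x) * L x = 0)
    (hV : ∑ x, Q x * Real.exp (s * L x) * L x ^ 2 ≤ V * ∑ x, Q x * Real.exp (s * L x)) :
    (∑ x, Q x * Real.exp (s * L x)) * Real.exp (-((τ + V / τ) / 4)) ≤
      ∑ x, min (Q x * Real.exp (L x)) (Q x) := by
  set m := (τ + V / τ) / 4 with hm
  set w : X → ℝ := fun x => Q x * Real.exp (s * L x) with hw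
  have hw0 : ∀ x, 0 ≤ w x := fun x => mul_nonneg (hQ x) (Real.exp_pos _).le
  have habs : ∀ x, |L x| / 2 ≤ (τ + L x ^ 2 / τ) / 4 := fun x => by
    have : 2 * |L x| ≤ τ + L x ^ 2 / τ := by
      rw [← sq_abs (L x)]
      have e : τ + |L x| ^ 2 / τ - 2 * |L x| = (τ - |L x|) ^ 2 / τ := by field_simp; ring
      have : 0 ≤ (τ - |L x|) ^ 2 / τ := by positivity
      linarith
    linarith
  -- Jensen by hand: `min(P, Q) = w * exp(L / 2 - |L| / 2 - s * L)`, and `exp u ≥ 1 + u` is applied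
  -- after shifting the exponent by `m`, chosen so that its `w`-average is then nonnegative.
  have hpt : ∀ x, Real.exp (-m) * (w x * (1 + m) + (1 / 2 - s) * (w x * L x)
      - (τ * w x + w x * L x ^ 2 / τ) / 4) ≤ min (Q x * Real.exp (L x)) (Q x) := fun x => by
    have e : min (Q x * Real.exp (L x)) (Q x) =
        w x * (Real.exp (-m) * Real.exp (m + L x / 2 - |L x| / 2 - s * L x)) := by
      rw [← Real.exp_add, hw, mul_assoc, ← Real.exp_add]
      rcases le_total 0 (L x) with h | h
      · rw [min_eq_right (le_mul_of_one_le_right (hQ x) (Real.one_le_exp h)), abs_of_nonneg h]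
        ring_nf; simp
      · rw [min_eq_left (mul_le_of_le_one_right (hQ x) (Real.exp_le_one_iff.2 h)),
          abs_of_nonpos h]
        ring_nf
    rw [e, mul_left_comm (w x) (Real.exp (-m))]
    refine mul_le_mul_of_nonneg_left ?_ (Real.exp_pos _).le
    have h1 := Real.add_one_le_exp (m + L x / 2 - |L x| / 2 - s * L x)
    have h2 := mul_le_mul_of_nonneg_left (h1.trans' (by linarith [habs x] :
      m + L x / 2 - (τ + L x ^ 2 / τ) / 4 - s * L x + 1 ≤ _)) (hw0 x)
    refine le_trans (le_of_eq ?_) h2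
    ring
  have hsum := Finset.sum_le_sum fun x (_ : x ∈ Finset.univ) => hpt x
  refine le_trans ?_ hsum
  rw [← Finset.mul_sum, mul_comm]
  refine mul_le_mul_of_nonneg_left ?_ (Real.exp_pos _).le
  rw [Finset.sum_sub_distrib, Finset.sum_add_distrib, ← Finset.sum_mul, ← Finset.mul_sum,
    ← Finset.sum_div, Finset.sum_add_distrib, ← Finset.mul_sum, ← Finset.sum_div]
  rw [show ∑ x, w x * L x = 0 from hs]
  have : (∑ x, w x * L x ^ 2) / τ ≤ V / τ * ∑ x, w x := by
    rw [div_mul_eq_mul_div]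
    exact div_le_div_of_nonneg_right hV hτ.le
  rw [hm]
  linarith

end Tilting

/-! ### Moments of sums of independent binary variables. -/

section Product

lemma sum_fin_succ_pi {N : ℕ} (F : (Fin (N + 1) → Bool) → ℝ) :
    ∑ e, F e = ∑ x : Bool, ∑ e : Fin N → Bool, F (Fin.cons x e) := by
  rw [← (Fin.consEquiv fun _ : Fin (N + 1) => Bool).sum_comp, Fintype.sum_prod_type]
  rfl

lemma sum_prod_eq_prod_sum {N : ℕ} (w : Fin N → Bool → ℝ) :
    ∑ e : Fin N → Bool, ∏ i, w i (e i) = ∏ i, ∑ x, w i x :=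
  (Fintype.prod_sum w).symm

lemma sum_prod_mul_sum {N : ℕ} {w a : Fin N → Bool → ℝ} (hw : ∀ i, ∑ x, w i x = 1) :
    ∑ e : Fin N → Bool, (∏ i, w i (e i)) * ∑ i, a i (e i) = ∑ i, ∑ x, w i x * a i x := by
  induction N with
  | zero => simp
  | succ n ih =>
    have h1 : ∑ e : Fin n → Bool, ∏ i, w i.succ (e i) = 1 := by
      rw [sum_prod_eq_prod_sum]; simp only [hw, Finset.prod_const_one]
    have h2 := ih (w := fun i => w i.succ) (a := fun i => a i.succ) fun i => hw i.succ
    rw [sum_fin_succ_pi, Fin.sum_univ_succ]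
    simp only [Fin.prod_univ_succ, Fin.sum_univ_succ, Fin.cons_zero, Fin.cons_succ]
    have h3 : ∀ x, ∑ e : Fin n → Bool, w 0 x * (∏ i, w i.succ (e i)) *
        (a 0 x + ∑ i, a i.succ (e i)) =
        w 0 x * a 0 x + w 0 x * ∑ i : Fin n, ∑ x, w i.succ x * a i.succ x := fun x => by
      rw [← h2, Finset.mul_sum, ← mul_one (w 0 x * a 0 x), ← h1, Finset.mul_sum,
        ← Finset.sum_add_distrib]
      exact Finset.sum_congr rfl fun e _ => by ring
    simp only [h3]
    rw [Finset.sum_add_distrib, ← Finset.sum_mul, hw 0, one_mul]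

/-- Centred independent variables: the second moment of the sum is the sum of second moments. -/
lemma sum_prod_mul_sq_sum {N : ℕ} {w a : Fin N → Bool → ℝ} (hw : ∀ i, ∑ x, w i x = 1)
    (ha : ∀ i, ∑ x, w i x * a i x = 0) :
    ∑ e : Fin N → Bool, (∏ i, w i (e i)) * (∑ i, a i (e i)) ^ 2 =
      ∑ i, ∑ x, w i x * a i x ^ 2 := by
  induction N with
  | zero => simp
  | succ n ih =>
    have h1 : ∑ e : Fin n → Bool, ∏ i, w i.succ (e i) = 1 := by
      rw [sum_prod_eq_prod_sum]; simp only [hw, Finset.prod_const_one]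
    have h2 := ih (w := fun i => w i.succ) (a := fun i => a i.succ) (fun i => hw i.succ)
      fun i => ha i.succ
    have h2' : ∑ e : Fin n → Bool, (∏ i, w i.succ (e i)) * ∑ i, a i.succ (e i) = 0 := by
      rw [sum_prod_mul_sum (w := fun i => w i.succ) (a := fun i => a i.succ) fun i => hw i.succ]
      simp only [ha, Finset.sum_const_zero]
    rw [sum_fin_succ_pi, Fin.sum_univ_succ]
    simp only [Fin.prod_univ_succ, Fin.sum_univ_succ, Fin.cons_zero, Fin.cons_succ]
    have h3 : ∀ x, ∑ e : Fin n → Bool, w 0 x * (∏ i, w i.succ (e i)) *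
        (a 0 x + ∑ i, a i.succ (e i)) ^ 2 =
        w 0 x * a 0 x ^ 2 + w 0 x * ∑ i : Fin n, ∑ x, w i.succ x * a i.succ x ^ 2 := fun x => by
      have e : ∀ e : Fin n → Bool, w 0 x * (∏ i, w i.succ (e i)) *
          (a 0 x + ∑ i, a i.succ (e i)) ^ 2 = w 0 x * a 0 x ^ 2 * ∏ i, w i.succ (e i)
          + 2 * w 0 x * a 0 x * ((∏ i, w i.succ (e i)) * ∑ i, a i.succ (e i))
          + w 0 x * ((∏ i, w i.succ (e i)) * (∑ i, a i.succ (e i)) ^ 2) := fun e => by ring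
      simp only [e]
      rw [Finset.sum_add_distrib, Finset.sum_add_distrib, ← Finset.mul_sum, ← Finset.mul_sum,
        ← Finset.mul_sum, h1, h2, h2']
      ring
    simp only [h3]
    rw [Finset.sum_add_distrib, ← Finset.sum_mul, hw 0, one_mul]

/-- If the sum of independent variables is centred, its second moment is at most the sum of second
moments. -/
lemma sum_prod_mul_sq_sum_le {N : ℕ} {w a : Fin N → Bool → ℝ} (hw : ∀ i, ∑ x, w i x = 1)
    (ha : ∑ e : Fin N → Bool, (∏ i, w i (e i)) * ∑ i, a i (e i) = 0) :
    ∑ e : Fin N → Bool, (∏ i, w i (e i)) * (∑ i, a i (e i)) ^ 2 ≤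
      ∑ i, ∑ x, w i x * a i x ^ 2 := by
  set m : Fin N → ℝ := fun i => ∑ x, w i x * a i x with hm
  have hsum : ∑ i, m i = 0 := by rw [← ha, sum_prod_mul_sum hw]
  have hcen : ∀ e : Fin N → Bool, ∑ i, a i (e i) = ∑ i, (a i (e i) - m i) := fun e => by
    rw [Finset.sum_sub_distrib, hsum, sub_zero]
  simp only [hcen]
  rw [sum_prod_mul_sq_sum (a := fun i x => a i x - m i) hw fun i => by
    simp only [mul_sub, Finset.sum_sub_distrib, ← Finset.sum_mul, hw i, one_mul]
    simp [hm]]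
  refine Finset.sum_le_sum fun i _ => ?_
  have : ∑ x, w i x * (a i x - m i) ^ 2 = ∑ x, w i x * a i x ^ 2 - m i ^ 2 := by
    have e : ∀ x, w i x * (a i x - m i) ^ 2 =
        w i x * a i x ^ 2 - 2 * m i * (w i x * a i x) + w i x * m i ^ 2 := fun x => by ring
    simp only [e]
    rw [Finset.sum_add_distrib, Finset.sum_sub_distrib, ← Finset.mul_sum, ← Finset.sum_mul, hw i]
    simp only [hm]
    ring
  rw [this]
  linarith [sq_nonneg (m i)]

end Product

/-! ### Second moments under tilting, and the Chernoff bound. -/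

lemma sq_mul_exp_neg_le {x δ : ℝ} (hδ : 0 < δ) (hx : 0 ≤ x) :
    x ^ 2 * Real.exp (-(δ * x)) ≤ 2 / δ ^ 2 := by
  have h := Real.quadratic_le_exp_of_nonneg (mul_nonneg hδ.le hx)
  have h' : (δ * x) ^ 2 / 2 ≤ Real.exp (δ * x) := h.trans' (by nlinarith [mul_nonneg hδ.le hx])
  rw [Real.exp_neg, ← div_eq_mul_inv, div_le_div_iff₀ (Real.exp_pos _) (by positivity)]
  nlinarith

/-- Log-likelihood ratios are unbounded over all tests, but tilting by `s` away from `0` and `1`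
leaves a factor `exp(-δ|l|)` that absorbs `l ^ 2`. This makes the variance bound uniform over tests.
-/
lemma mul_exp_mul_sq_le {q l s δ : ℝ} (hδ : 0 < δ) (hs : δ ≤ s) (hs' : s ≤ 1 - δ)
    (hq : q ∈ Icc (0 : ℝ) 1) (hp : q * Real.exp l ≤ 1) :
    q * Real.exp (s * l) * l ^ 2 ≤ 2 / δ ^ 2 := by
  rcases le_total 0 l with h | h
  · have e : Real.exp (s * l) ≤ Real.exp l * Real.exp (-(δ * l)) := by
      rw [← Real.exp_add]; exact Real.exp_le_exp.2 (by nlinarith)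
    have := sq_mul_exp_neg_le hδ h
    calc q * Real.exp (s * l) * l ^ 2 ≤ q * (Real.exp l * Real.exp (-(δ * l))) * l ^ 2 := by
          gcongr; exact hq.1
      _ = q * Real.exp l * (l ^ 2 * Real.exp (-(δ * l))) := by ring
      _ ≤ 1 * (2 / δ ^ 2) := by gcongr
      _ = _ := one_mul _
  · have := sq_mul_exp_neg_le hδ (neg_nonneg.2 h)
    calc q * Real.exp (s * l) * l ^ 2 ≤ 1 * Real.exp (-(δ * -l)) * l ^ 2 := by
          gcongr
          · exact hq.2
          · nlinarith
      _ = (-l) ^ 2 * Real.exp (-(δ * -l)) := by ring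
      _ ≤ _ := this

lemma sum_bern (t : ℝ) : ∑ x, bern t x = 1 := by simp [bern]

lemma bern_mem_Icc {t : ℝ} (ht : t ∈ Icc (0 : ℝ) 1) (x : Bool) : bern t x ∈ Icc (0 : ℝ) 1 := by
  cases x
  · exact ⟨by simpa [bern] using ht.2, by simpa [bern] using ht.1⟩
  · simpa [bern] using ht

/-- Chernoff bound for independent identical tests. -/
lemma sum_min_le_affinity_pow {s p q : ℝ} (hs : s ∈ Icc (0 : ℝ) 1) (hp : p ∈ Icc (0 : ℝ) 1)
    (hq : q ∈ Icc (0 : ℝ) 1) (N : ℕ) :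
    ∑ e : Fin N → Bool, min (∏ i, bern p (e i)) (∏ i, bern q (e i)) ≤ affinity s p q ^ N := by
  have hmin : ∀ x y : ℝ, 0 ≤ x → 0 ≤ y → min x y ≤ x ^ s * y ^ (1 - s) := fun x y hx hy => by
    have hm : 0 ≤ min x y := le_min hx hy
    calc min x y = min x y ^ s * min x y ^ (1 - s) := by
          rw [← Real.rpow_add' hm (by simp)]; simp
      _ ≤ _ := mul_le_mul (Real.rpow_le_rpow hm (min_le_left _ _) hs.1)
          (Real.rpow_le_rpow hm (min_le_right _ _) (sub_nonneg.2 hs.2))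
          (Real.rpow_nonneg hm _) (Real.rpow_nonneg hx _)
  calc _ ≤ ∑ e : Fin N → Bool, ∏ i, bern p (e i) ^ s * bern q (e i) ^ (1 - s) := by
        refine Finset.sum_le_sum fun e _ => ?_
        rw [Finset.prod_mul_distrib, Real.finsetProd_rpow _ _ fun i _ => (bern_mem_Icc hp _).1,
          Real.finsetProd_rpow _ _ fun i _ => (bern_mem_Icc hq _).1]
        exact hmin _ _ (Finset.prod_nonneg fun i _ => (bern_mem_Icc hp _).1)
          (Finset.prod_nonneg fun i _ => (bern_mem_Icc hq _).1)
    _ = _ := by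
        rw [sum_prod_eq_prod_sum (w := fun _ x => bern p x ^ s * bern q x ^ (1 - s))]
        simp only [affinity_eq_sum_bern, Fin.prod_const]

/-! ### The converse for independent, not necessarily identical tests. -/

namespace IsTestRegion

variable {K : Set (ℝ × ℝ)}

lemma bern_fst_eq_zero_iff (hK : IsTestRegion K) {y : ℝ × ℝ} (hy : y ∈ K) (x : Bool) :
    bern y.1 x = 0 ↔ bern y.2 x = 0 := by
  cases x
  · exact ⟨fun h => hK.snd_eq_zero (hK.compl_mem y hy) (by simpa [bern] using h),
      fun h => hK.fst_eq_zero (hK.compl_mem y hy) (by simpa [bern] using h)⟩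
  · exact ⟨fun h => hK.snd_eq_zero hy h, fun h => hK.fst_eq_zero hy h⟩

/-- The log-likelihood ratio of the outcome of a test. -/
lemma bern_mul_exp_log (hK : IsTestRegion K) {y : ℝ × ℝ} (hy : y ∈ K) (x : Bool) :
    bern y.2 x * Real.exp (Real.log (bern y.1 x / bern y.2 x)) = bern y.1 x := by
  have h1 := (bern_mem_Icc (hK.mem_Icc y hy).1 x).1
  have h2 := (bern_mem_Icc (hK.mem_Icc y hy).2 x).1
  rcases h2.eq_or_lt with h | h
  -- An outcome impossible under one law is impossible under both, so the default value of the
  -- logarithm is harmless.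
  · rw [← h, zero_mul, (hK.bern_fst_eq_zero_iff hy x).2 h.symm]
  · have h1' : 0 < bern y.1 x := lt_of_le_of_ne h1 fun e =>
      h.ne' ((hK.bern_fst_eq_zero_iff hy x).1 e.symm)
    rw [Real.exp_log (div_pos h1' h)]
    field_simp

lemma sum_bern_mul_exp_log (hK : IsTestRegion K) {y : ℝ × ℝ} (hy : y ∈ K) {s : ℝ}
    (hs : s ∈ Ioo (0 : ℝ) 1) :
    ∑ x, bern y.2 x * Real.exp (s * Real.log (bern y.1 x / bern y.2 x)) =
      affinity s y.1 y.2 := by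
  rw [← affinity_eq_sum_bern]
  refine Finset.sum_congr rfl fun x _ => ?_
  have h1 := (bern_mem_Icc (hK.mem_Icc y hy).1 x).1
  have h2 := (bern_mem_Icc (hK.mem_Icc y hy).2 x).1
  rcases h2.eq_or_lt with h | h
  · rw [← h, zero_mul, Real.zero_rpow (by linarith [hs.2]), mul_zero]
  · have h1' : 0 < bern y.1 x := lt_of_le_of_ne h1 fun e =>
      h.ne' ((hK.bern_fst_eq_zero_iff hy x).1 e.symm)
    rw [mul_comm s, ← Real.rpow_def_of_pos (div_pos h1' h), Real.div_rpow h1 h2,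
      Real.rpow_sub h, Real.rpow_one]
    field_simp

/-- Converse bound: no sequence of independent tests has an error exponent above `-log ζ`, where
`ζ` is a lower bound of all affinities. -/
lemma exists_le_sum_min (hK : IsTestRegion K) {ζ : ℝ} (hζ : ζ ∈ Ioo (0 : ℝ) 1)
    (hmin : ∀ y ∈ K, ∀ t ∈ Icc (0 : ℝ) 1, ζ ≤ affinity t y.1 y.2) {ε : ℝ} (hε : 0 < ε) :
    ∃ c > 0, ∀ (N : ℕ) (y : Fin N → ℝ × ℝ), (∀ i, y i ∈ K) →
      c * (ζ * Real.exp (-ε)) ^ N ≤ ∑ e : Fin N → Bool,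
        min (∏ i, bern (y i).1 (e i)) (∏ i, bern (y i).2 (e i)) := by
  -- The square root offsets the square lost to Cauchy-Schwarz when the tilt `s` falls near `0` or
  -- `1`.
  have hr : √ζ < 1 := by rw [Real.sqrt_lt' one_pos]; simpa using hζ.2
  obtain ⟨δ, hδ, hedge⟩ := hK.exists_affinity_ge hr
  -- Bound for one agent's tilted second moment: two outcomes at `2 / δ ^ 2` each, divided by a
  -- normalizer that is at least `ζ`.
  set C := 4 / δ ^ 2 / ζ with hC
  have hδ0 := hδ.1
  have hζ0 := hζ.1
  refine ⟨min (1 / 2) (Real.exp (-1 - C / (4 * ε))), by positivity, fun N y hy => ?_⟩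
  set l : Fin N → Bool → ℝ := fun i x => Real.log (bern (y i).1 x / bern (y i).2 x) with hl
  set Q : (Fin N → Bool) → ℝ := fun e => ∏ i, bern (y i).2 (e i) with hQdef
  set L : (Fin N → Bool) → ℝ := fun e => ∑ i, l i (e i) with hL
  have hQ0 : ∀ e, 0 ≤ Q e := fun e => Finset.prod_nonneg fun i _ =>
    (bern_mem_Icc (hK.mem_Icc _ (hy i)).2 _).1
  have hQ1 : ∑ e, Q e = 1 := by
    simp only [hQdef]
    rw [sum_prod_eq_prod_sum (w := fun i => bern (y i).2)]
    simp only [sum_bern, Finset.prod_const_one]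
  have hexp : ∀ s e, Q e * Real.exp (s * L e) =
      ∏ i, bern (y i).2 (e i) * Real.exp (s * l i (e i)) := fun s e => by
    rw [Finset.prod_mul_distrib, hL, Finset.mul_sum, Real.exp_sum]
  have hPeq : ∀ e, Q e * Real.exp (L e) = ∏ i, bern (y i).1 (e i) := fun e => by
    have := hexp 1 e
    simp only [one_mul] at this
    rw [this]
    exact Finset.prod_congr rfl fun i _ => hK.bern_mul_exp_log (hy i) (e i)
  have hP1 : ∑ e, Q e * Real.exp (L e) = 1 := by
    simp only [hPeq]
    rw [sum_prod_eq_prod_sum (w := fun i => bern (y i).1)]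
    simp only [sum_bern, Finset.prod_const_one]
  have hg : ∀ s ∈ Ioo (0 : ℝ) 1, ∑ e, Q e * Real.exp (s * L e) =
      ∏ i, affinity s (y i).1 (y i).2 := fun s hs => by
    simp only [hexp]
    rw [sum_prod_eq_prod_sum (w := fun i x => bern (y i).2 x * Real.exp (s * l i x))]
    exact Finset.prod_congr rfl fun i _ => hK.sum_bern_mul_exp_log (hy i) hs
  simp only [← hPeq]
  obtain ⟨s, hs, hs0⟩ := exists_tilt_mean_zero hQ1 hP1
  have hsI := Ioo_subset_Icc_self hs
  have hexpN : Real.exp (-ε) ^ N ≤ 1 :=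
    pow_le_one₀ (Real.exp_pos _).le (Real.exp_le_one_iff.2 (by linarith))
  by_cases hsδ : s ≤ δ ∨ 1 - δ ≤ s
  · refine le_trans ?_ (half_sq_sum_tilt_le_sum_min hQ0 hQ1 hP1)
    have h1 : √ζ ^ N ≤ ∑ e, Q e * Real.exp (1 / 2 * L e) := by
      refine le_trans ?_ (sum_tilt_le_of_mean_zero hQ0 hs0 _)
      rw [hg s hs, ← Fin.prod_const]
      exact Finset.prod_le_prod (fun _ _ => Real.sqrt_nonneg _)
        fun i _ => hedge _ (hy i) s hsI hsδ
    have h2 : ζ ^ N ≤ (∑ e, Q e * Real.exp (1 / 2 * L e)) ^ 2 := by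
      have := pow_le_pow_left₀ (by positivity) h1 2
      rwa [← pow_mul, mul_comm N, pow_mul, Real.sq_sqrt hζ0.le] at this
    have h3 : (ζ * Real.exp (-ε)) ^ N ≤ ζ ^ N := by
      rw [mul_pow]
      exact mul_le_of_le_one_right (by positivity) hexpN
    have h4 : min (1 / 2) (Real.exp (-1 - C / (4 * ε))) * (ζ * Real.exp (-ε)) ^ N ≤
        1 / 2 * ζ ^ N := by
      gcongr
      exact min_le_left _ _
    linarith
  · push Not at hsδ
    set a : Fin N → ℝ := fun i => affinity s (y i).1 (y i).2 with ha
    have haζ : ∀ i, ζ ≤ a i := fun i => hmin _ (hy i) s hsI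
    have ha0 : ∀ i, 0 < a i := fun i => hζ0.trans_le (haζ i)
    set w : Fin N → Bool → ℝ := fun i x => bern (y i).2 x * Real.exp (s * l i x) / a i with hw
    have hw1 : ∀ i, ∑ x, w i x = 1 := fun i => by
      simp only [hw]
      rw [← Finset.sum_div, hK.sum_bern_mul_exp_log (hy i) hs, div_self (ha0 i).ne']
    have hA0 : 0 < ∏ i, a i := Finset.prod_pos fun i _ => ha0 i
    have hwQ : ∀ e, ∏ i, w i (e i) = Q e * Real.exp (s * L e) / ∏ i, a i := fun e => by
      rw [hexp, ← Finset.prod_div_distrib]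
    have hmean : ∑ e : Fin N → Bool, (∏ i, w i (e i)) * ∑ i, l i (e i) = 0 := by
      have : ∀ e : Fin N → Bool, (∏ i, w i (e i)) * ∑ i, l i (e i) =
          Q e * Real.exp (s * L e) * L e / ∏ i, a i := fun e => by rw [hwQ]; ring
      simp only [this]
      rw [← Finset.sum_div, hs0, zero_div]
    have hvar := sum_prod_mul_sq_sum_le hw1 hmean
    have hone : ∀ i, ∑ x, w i x * l i x ^ 2 ≤ C := fun i => by
      have hb : ∀ x, bern (y i).2 x * Real.exp (s * l i x) * l i x ^ 2 ≤ 2 / δ ^ 2 := fun x =>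
        mul_exp_mul_sq_le hδ0 hsδ.1.le hsδ.2.le (bern_mem_Icc (hK.mem_Icc _ (hy i)).2 x)
          ((hK.bern_mul_exp_log (hy i) x).le.trans (bern_mem_Icc (hK.mem_Icc _ (hy i)).1 x).2)
      have e : ∑ x, w i x * l i x ^ 2 =
          (∑ x, bern (y i).2 x * Real.exp (s * l i x) * l i x ^ 2) / a i := by
        rw [Finset.sum_div]
        exact Finset.sum_congr rfl fun x _ => by simp only [hw]; ring
      rw [e, hC]
      refine div_le_div₀ (by positivity) ?_ hζ0 (haζ i)
      rw [Fintype.sum_bool]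
      linarith [hb true, hb false, (by ring : 4 / δ ^ 2 = 2 / δ ^ 2 + 2 / δ ^ 2)]
    have hV : ∑ e, Q e * Real.exp (s * L e) * L e ^ 2 ≤
        (N * C) * ∑ e, Q e * Real.exp (s * L e) := by
      have h1 : ∑ i, ∑ x, w i x * l i x ^ 2 ≤ N * C := by
        refine (Finset.sum_le_sum fun i _ => hone i).trans ?_
        simp
      have h2 : ∑ e, Q e * Real.exp (s * L e) * L e ^ 2 = (∑ e : Fin N → Bool,
          (∏ i, w i (e i)) * (∑ i, l i (e i)) ^ 2) * ∏ i, a i := by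
        rw [Finset.sum_mul]
        refine Finset.sum_congr rfl fun e _ => ?_
        rw [hwQ]
        field_simp
        rfl
      rw [h2, hg s hs]
      exact mul_le_mul_of_nonneg_right (hvar.trans h1) hA0.le
    -- With this `τ`, the loss `(τ + N * C / τ) / 4` is at most `ε * N + 1 + C / (4 * ε)`; the
    -- summand `4` keeps `τ` positive at `N = 0`.
    have hτ : 0 < 4 * ε * N + 4 := by positivity
    refine le_trans ?_ (sum_tilt_mul_exp_le_sum_min hQ0 hτ hs0 hV)
    have hZ : ζ ^ N ≤ ∑ e, Q e * Real.exp (s * L e) := by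
      rw [hg s hs, ← Fin.prod_const]
      exact Finset.prod_le_prod (fun _ _ => hζ0.le) fun i _ => haζ i
    have hC0 : 0 < C := by positivity
    have hfrac : N * C / (4 * ε * N + 4) ≤ C / ε := by
      rw [div_le_div_iff₀ hτ hε]
      nlinarith [mul_nonneg (Nat.cast_nonneg (α := ℝ) N) (mul_pos hC0 hε).le]
    have hE : Real.exp (-1 - C / (4 * ε)) * Real.exp (-ε) ^ N ≤
        Real.exp (-((4 * ε * N + 4 + N * C / (4 * ε * N + 4)) / 4)) := by
      rw [← Real.exp_nat_mul, ← Real.exp_add]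
      refine Real.exp_le_exp.2 ?_
      have : C / (4 * ε) = C / ε / 4 := by ring
      rw [this]
      linarith
    calc min (1 / 2) (Real.exp (-1 - C / (4 * ε))) * (ζ * Real.exp (-ε)) ^ N
        ≤ Real.exp (-1 - C / (4 * ε)) * (ζ * Real.exp (-ε)) ^ N := by
          gcongr
          exact min_le_right _ _
      _ = ζ ^ N * (Real.exp (-1 - C / (4 * ε)) * Real.exp (-ε) ^ N) := by rw [mul_pow]; ring
      _ ≤ _ := mul_le_mul hZ hE (by positivity) (hZ.trans' (by positivity))

end IsTestRegion

/-! ### Uniform absolute continuity for randomized tests. -/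

lemma MeasureTheory.exists_measure_lt_of_ac {α : Type*} [MeasurableSpace α] {μ ν : Measure α}
    [IsFiniteMeasure μ] [IsFiniteMeasure ν] (h : ν ≪ μ) {ε : ℝ≥0∞} (hε : ε ≠ 0) :
    ∃ δ > 0, ∀ s, MeasurableSet s → μ s < δ → ν s < ε := by
  obtain ⟨δ, hδ, H⟩ := exists_pos_setLIntegral_lt_of_measure_lt
    (μ := μ) (f := ν.rnDeriv μ) (Measure.lintegral_rnDeriv_lt_top ν μ).ne hε
  exact ⟨δ, hδ, fun s _ hμ => by simpa [Measure.setLIntegral_rnDeriv h] using H s hμ⟩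

lemma IsTest.integrable {α : Type*} [MeasurableSpace α] {φ : α → ℝ} (hφ : IsTest φ)
    (μ : Measure α) [IsFiniteMeasure μ] : Integrable φ μ :=
  Integrable.of_bound hφ.1.aestronglyMeasurable 1 (Eventually.of_forall fun x => by
    rw [Real.norm_of_nonneg (hφ.2 x).1]; exact (hφ.2 x).2)

lemma IsTest.one_sub {α : Type*} [MeasurableSpace α] {φ : α → ℝ} (hφ : IsTest φ) :
    IsTest fun x => 1 - φ x :=
  ⟨measurable_const.sub hφ.1, fun x => ⟨sub_nonneg.2 (hφ.2 x).2, by linarith [(hφ.2 x).1]⟩⟩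

lemma IsTest.integral_mem_Icc {α : Type*} [MeasurableSpace α] {φ : α → ℝ} (hφ : IsTest φ)
    (μ : Measure α) [IsProbabilityMeasure μ] : ∫ x, φ x ∂μ ∈ Icc (0 : ℝ) 1 := by
  refine ⟨integral_nonneg fun x => (hφ.2 x).1, ?_⟩
  simpa using integral_mono (hφ.integrable μ) (integrable_const (1 : ℝ)) fun x => (hφ.2 x).2

lemma IsTest.integral_one_sub {α : Type*} [MeasurableSpace α] {φ : α → ℝ} (hφ : IsTest φ)
    (μ : Measure α) [IsProbabilityMeasure μ] : ∫ x, (1 - φ x) ∂μ = 1 - ∫ x, φ x ∂μ := by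
  rw [integral_sub (integrable_const _) (hφ.integrable μ)]; simp

lemma isTest_const {α : Type*} [MeasurableSpace α] {c : ℝ} (hc : c ∈ Icc (0 : ℝ) 1) :
    IsTest fun _ : α => c := ⟨measurable_const, fun _ => hc⟩

/-- Absolute continuity, for tests in place of events. -/
lemma exists_integral_le_of_ac {α : Type*} [MeasurableSpace α] {μ ν : Measure α}
    [IsProbabilityMeasure μ] [IsProbabilityMeasure ν] (h : ν ≪ μ) {ε : ℝ} (hε : 0 < ε) :
    ∃ η > 0, ∀ φ : α → ℝ, IsTest φ → ∫ x, φ x ∂μ < η → ∫ x, φ x ∂ν ≤ ε := by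
  obtain ⟨δ, hδ, H⟩ := exists_measure_lt_of_ac h (ε := ENNReal.ofReal (ε / 2)) (by simpa)
  set d := min δ 1 with hd
  have hd0 : 0 < d := lt_min hδ one_pos
  have hdtop : d ≠ ⊤ := ne_top_of_le_ne_top ENNReal.one_ne_top (min_le_right _ _)
  have hdr : 0 < d.toReal := ENNReal.toReal_pos hd0.ne' hdtop
  refine ⟨ε / 2 * d.toReal, by positivity, fun φ hφ hlt => ?_⟩
  -- Markov's inequality makes `μ A` small, hence `ν A` small, and `φ ≤ 1_A + ε / 2`.
  set A : Set α := {x | ε / 2 ≤ φ x} with hA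
  have hAm : MeasurableSet A := measurableSet_le measurable_const hφ.1
  have hmarkov := mul_meas_ge_le_integral_of_nonneg (Eventually.of_forall fun x => (hφ.2 x).1)
    (hφ.integrable μ) (ε / 2)
  have h1 : μ.real A < d.toReal := by
    have := hmarkov.trans_lt hlt
    exact lt_of_mul_lt_mul_left this (by positivity)
  have h2 : μ A < δ := ((ENNReal.toReal_lt_toReal (measure_ne_top _ _) hdtop).1 h1).trans_le
    (min_le_left _ _)
  have h3 : ν.real A ≤ ε / 2 := by
    have := ENNReal.toReal_mono ENNReal.ofReal_ne_top (H A hAm h2).le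
    rwa [ENNReal.toReal_ofReal (by positivity)] at this
  have hind : Integrable (A.indicator (1 : α → ℝ)) ν := (integrable_const (1 : ℝ)).indicator hAm
  calc ∫ x, φ x ∂ν ≤ ∫ x, (A.indicator 1 x + ε / 2) ∂ν := by
        refine integral_mono (hφ.integrable ν) (hind.add (integrable_const _)) fun x => ?_
        by_cases hx : x ∈ A
        · simp only [indicator_of_mem hx, Pi.one_apply]
          linarith [(hφ.2 x).2]
        · simp only [indicator_of_notMem hx, zero_add]
          exact (not_le.1 hx).le
    _ = ν.real A + ε / 2 := by
        rw [integral_add hind (integrable_const _), integral_indicator_one hAm]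
        simp
    _ ≤ ε := by linarith

/-! ### Tests of one private signal and the Neyman-Pearson lemma. -/

namespace StarModel

variable (M : StarModel)

/-- The probability, given `H = h`, that the test `φ` decides `1`. -/
noncomputable def testProb (φ : ℝ → ℝ) (h : Bool) : ℝ := ∫ y, φ y ∂(M.P h)

/-- The pairs of probabilities, under the two hypotheses, with which tests decide `1`. -/
def testRegion : Set (ℝ × ℝ) :=
  {x | ∃ φ, IsTest φ ∧ (M.testProb φ false, M.testProb φ true) = x}

variable {M}

lemma mem_testRegion {φ : ℝ → ℝ} (hφ : IsTest φ) :
    (M.testProb φ false, M.testProb φ true) ∈ M.testRegion := ⟨φ, hφ, rfl⟩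

lemma decisionProb_eq_bern {φ : ℝ → ℝ} (hφ : IsTest φ) (d h : Bool) :
    M.decisionProb φ d h = bern (M.testProb φ h) d := by
  cases d
  · simp [decisionProb, bern, testProb, hφ.integral_one_sub]
  · simp [decisionProb, bern, testProb]

lemma testProb_one_sub {φ : ℝ → ℝ} (hφ : IsTest φ) (h : Bool) :
    M.testProb (fun y => 1 - φ y) h = 1 - M.testProb φ h := hφ.integral_one_sub _

variable (M)

lemma isTestRegion_testRegion : IsTestRegion M.testRegion where
  mem_Icc := by
    rintro _ ⟨φ, hφ, rfl⟩
    exact ⟨hφ.integral_mem_Icc _, hφ.integral_mem_Icc _⟩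
  compl_mem := by
    rintro _ ⟨φ, hφ, rfl⟩
    exact ⟨_, hφ.one_sub, by simp only [testProb_one_sub hφ]⟩
  uniform_ac ε hε := by
    obtain ⟨η₁, h₁, H₁⟩ := exists_integral_le_of_ac (M.ac true false) hε (ν := M.P true)
      (μ := M.P false)
    obtain ⟨η₂, h₂, H₂⟩ := exists_integral_le_of_ac (M.ac false true) hε (ν := M.P false)
      (μ := M.P true)
    refine ⟨min η₁ η₂, lt_min h₁ h₂, ?_⟩
    rintro _ ⟨φ, hφ, rfl⟩
    exact ⟨fun h => H₁ φ hφ (h.trans_le (min_le_left _ _)),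
      fun h => H₂ φ hφ (h.trans_le (min_le_right _ _))⟩

lemma exists_testRegion_ne : ∃ x ∈ M.testRegion, x.1 ≠ x.2 := by
  by_contra! H
  refine M.ne (Measure.ext fun A hA => ?_)
  have hφ : IsTest (A.indicator (1 : ℝ → ℝ)) := by
    refine ⟨measurable_one.indicator hA, fun x => ?_⟩
    by_cases hx : x ∈ A
    · simp [hx]
    · simp [hx]
  have h := H _ (mem_testRegion (M := M) hφ)
  simp only [testProb, integral_indicator_one hA] at h
  exact (ENNReal.toReal_eq_toReal_iff' (measure_ne_top (M.P false) A)
    (measure_ne_top (M.P true) A)).1 h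

lemma testProb_eq_integral (φ : ℝ → ℝ) (h : Bool) : M.testProb φ h = ∫ y, M.f h y * φ y := by
  rw [testProb, P, integral_withDensity_eq_integral_toReal_smul
    (M.measurable_f h).ennreal_ofReal (Eventually.of_forall fun _ => ENNReal.ofReal_lt_top)]
  simp [ENNReal.toReal_ofReal (M.nonneg_f h _)]

variable {M} in
lemma integrable_density_mul {φ : ℝ → ℝ} (hφ : IsTest φ) (h : Bool) :
    Integrable (fun y => M.f h y * φ y) := by
  have := (integrable_withDensity_iff_integrable_smul' (M.measurable_f h).ennreal_ofReal
    (Eventually.of_forall fun _ => ENNReal.ofReal_lt_top)).1 (hφ.integrable (M.P h))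
  simpa [ENNReal.toReal_ofReal (M.nonneg_f h _)] using this

/-- Where `M.f false` vanishes, `M.LR` has the default value `0` of division by zero; this lemma
makes such points negligible in `lrt_optimal`. -/
lemma ae_density_true_eq_zero : ∀ᵐ y, M.f false y = 0 → M.f true y = 0 := by
  have hs : MeasurableSet {y | M.f false y = 0} := M.measurable_f false (measurableSet_singleton 0)
  have h0 : M.P false {y | M.f false y = 0} = 0 := by
    rw [P, withDensity_apply _ hs, setLIntegral_congr_fun hs (g := fun _ => 0)
      fun y hy => by simp [show M.f false y = 0 from hy]]
    simp
  have h1 : M.P true {y | M.f false y = 0} = 0 := M.ac true false h0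
  rw [P, withDensity_apply _ hs,
    setLIntegral_eq_zero_iff hs (M.measurable_f true).ennreal_ofReal] at h1
  filter_upwards [h1] with y hy h
  exact le_antisymm (ENNReal.ofReal_eq_zero.1 (hy h)) (M.nonneg_f true y)

/-- Neyman-Pearson lemma: likelihood ratio tests optimize linear functionals of the probabilities
of error, whatever the tie rule. -/
lemma lrt_optimal (T : TieRule) (l : ℝ) {φ : ℝ → ℝ} (hφ : IsTest φ) :
    l * M.testProb (M.lrt T l) false - M.testProb (M.lrt T l) true ≤
      l * M.testProb φ false - M.testProb φ true := by
  have hψ := M.isTest_lrt T l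
  simp only [testProb_eq_integral]
  rw [← integral_const_mul, ← integral_const_mul, ← integral_sub
    ((integrable_density_mul hψ false).const_mul l) (integrable_density_mul hψ true),
    ← integral_sub ((integrable_density_mul hφ false).const_mul l)
      (integrable_density_mul hφ true)]
  refine integral_mono_ae
    (((integrable_density_mul hψ false).const_mul l).sub (integrable_density_mul hψ true))
    (((integrable_density_mul hφ false).const_mul l).sub (integrable_density_mul hφ true)) ?_
  filter_upwards [M.ae_density_true_eq_zero] with y hy
  rcases (M.nonneg_f false y).eq_or_lt with h | h
  · simp [← h, hy h.symm]
  have hφy := hφ.2 y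
  -- The pointwise minimizer is `1` where the coefficient is negative and `0` where it is positive;
  -- at a tie the coefficient vanishes, so any tie rule is optimal.
  suffices H : (l * M.f false y - M.f true y) * M.lrt T l y ≤
      (l * M.f false y - M.f true y) * φ y by
    linarith
  by_cases hmem : y ∈ {y | l < M.LR y} ∪ {y | M.LR y = l} ∩ T.1
  · have hle : l ≤ M.LR y := by
      rcases hmem with h' | h'
      · exact le_of_lt h'
      · exact h'.1.ge
    have : l * M.f false y ≤ M.f true y := (le_div_iff₀ h).1 hle
    simp only [lrt, indicator_of_mem hmem, Pi.one_apply]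
    nlinarith [hφy.2]
  · have hle : M.LR y ≤ l := not_lt.1 fun h' => hmem (Or.inl h')
    have : M.f true y ≤ l * M.f false y := (div_le_iff₀ h).1 hle
    simp only [lrt, indicator_of_notMem hmem]
    nlinarith [hφy.1]

/-- Comparison with the constant test `0` gives Markov's inequality for the likelihood ratio; the
constant test `1` gives the dual bound in `one_sub_testProb_lrt_le`. -/
lemma mul_testProb_lrt_le (T : TieRule) (l : ℝ) :
    l * M.testProb (M.lrt T l) false ≤ 1 := by
  have h := M.lrt_optimal T l (isTest_const (c := 0) ⟨le_rfl, zero_le_one⟩)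
  have h1 := (M.isTestRegion_testRegion.mem_Icc _ (mem_testRegion (M.isTest_lrt T l))).2.2
  simp only [testProb, integral_zero, mul_zero, sub_zero] at h h1 ⊢
  linarith

lemma one_sub_testProb_lrt_le (T : TieRule) {l : ℝ} (hl : 0 < l) :
    1 - M.testProb (M.lrt T l) true ≤ l := by
  have h := M.lrt_optimal T l (isTest_const (c := 1) ⟨zero_le_one, le_rfl⟩)
  have h1 := (M.isTestRegion_testRegion.mem_Icc _ (mem_testRegion (M.isTest_lrt T l))).1.1
  simp only [testProb, integral_const, probReal_univ, smul_eq_mul, mul_one] at h h1 ⊢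
  linarith [mul_nonneg hl.le h1]

/-- A private signal cannot make both error probabilities of a decision small. -/
lemma exists_le_testProb_add :
    ∃ κ > 0, ∀ φ, IsTest φ → κ ≤ M.testProb φ false + (1 - M.testProb φ true) := by
  obtain ⟨η, hη, H⟩ := M.isTestRegion_testRegion.uniform_ac (1 / 2) (by norm_num)
  refine ⟨min η (1 / 2), by positivity, fun φ hφ => ?_⟩
  have hm := mem_testRegion (M := M) hφ
  have hI := M.isTestRegion_testRegion.mem_Icc _ hm
  rcases lt_or_ge (M.testProb φ false) η with h | h
  · have := (H _ hm).1 h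
    have := hI.1.1
    exact (min_le_right _ _).trans (by simp only at *; linarith)
  · have := hI.2.2
    exact (min_le_left _ _).trans (by simp only at *; linarith)

end StarModel

/-! ### Chernoff information in terms of the least affinity. -/

lemma chernoffInfo_bern (p q : ℝ) :
    chernoffInfo (bern p) (bern q) = -⨅ s : Icc (0 : ℝ) 1, Real.log (affinity s p q) := by
  simp only [chernoffInfo, affinity_eq_sum_bern]

lemma IsTestRegion.chernoffInfo_le {K : Set (ℝ × ℝ)} {ζ : ℝ} (hζ : 0 < ζ)
    (hmin : ∀ y ∈ K, ∀ t ∈ Icc (0 : ℝ) 1, ζ ≤ affinity t y.1 y.2) {y : ℝ × ℝ} (hy : y ∈ K) :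
    chernoffInfo (bern y.1) (bern y.2) ≤ -Real.log ζ := by
  rw [chernoffInfo_bern]
  exact neg_le_neg (le_ciInf fun s => Real.log_le_log hζ (hmin y hy s s.2))

lemma IsTestRegion.neg_log_affinity_le_chernoffInfo {K : Set (ℝ × ℝ)} {ζ : ℝ} (hζ : 0 < ζ)
    (hmin : ∀ y ∈ K, ∀ t ∈ Icc (0 : ℝ) 1, ζ ≤ affinity t y.1 y.2) {y : ℝ × ℝ} (hy : y ∈ K) {s : ℝ}
    (hs : s ∈ Icc (0 : ℝ) 1) :
    -Real.log (affinity s y.1 y.2) ≤ chernoffInfo (bern y.1) (bern y.2) := by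
  rw [chernoffInfo_bern]
  exact neg_le_neg (ciInf_le ⟨Real.log ζ, by
    rintro _ ⟨t, rfl⟩
    exact Real.log_le_log hζ (hmin y hy t t.2)⟩ (⟨s, hs⟩ : Icc (0 : ℝ) 1))

/-! ### From bounds on risks to exponents. -/

section Exponents

variable {R : ℕ → ℝ} {ζ : ℝ}

lemma eventually_exponentAt_le (hζ : 0 < ζ)
    (h : ∀ ε > 0, ∃ c > 0, ∀ N : ℕ, c * (ζ * Real.exp (-ε)) ^ N ≤ R N) {ε : ℝ} (hε : 0 < ε) :
    ∀ᶠ N in atTop, exponentAt R N < -Real.log ζ + ε := by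
  obtain ⟨c, hc, H⟩ := h (ε / 2) (by positivity)
  have hlim : Tendsto (fun N : ℕ => -Real.log c / N) atTop (𝓝 0) :=
    tendsto_const_div_atTop_nhds_zero_nat _
  filter_upwards [hlim.eventually (gt_mem_nhds (show (0 : ℝ) < ε / 2 by positivity)),
    eventually_gt_atTop 0] with N hN hN0
  have hN0' : (0 : ℝ) < N := Nat.cast_pos.2 hN0
  have hlog := Real.log_le_log (by positivity) (H N)
  rw [Real.log_mul hc.ne' (by positivity), Real.log_pow, Real.log_mul hζ.ne'
    (Real.exp_pos _).ne', Real.log_exp] at hlog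
  have e : exponentAt R N = -Real.log (R N) / N := by unfold exponentAt; ring
  rw [e, div_lt_iff₀ hN0']
  rw [div_lt_iff₀ hN0'] at hN
  linarith

lemma eventually_lt_exponentAt (hζ : 0 < ζ) (hpos : ∀ N, 0 < R N) {C : ℝ} (hC : 0 < C)
    (h : ∀ N : ℕ, R N ≤ C * ζ ^ N) {ε : ℝ} (hε : 0 < ε) :
    ∀ᶠ N in atTop, -Real.log ζ - ε < exponentAt R N := by
  have hlim : Tendsto (fun N : ℕ => Real.log C / N) atTop (𝓝 0) :=
    tendsto_const_div_atTop_nhds_zero_nat _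
  filter_upwards [hlim.eventually (gt_mem_nhds hε), eventually_gt_atTop 0] with N hN hN0
  have hN0' : (0 : ℝ) < N := Nat.cast_pos.2 hN0
  have hlog := Real.log_le_log (hpos N) (h N)
  rw [Real.log_mul hC.ne' (by positivity), Real.log_pow] at hlog
  have e : exponentAt R N = -Real.log (R N) / N := by unfold exponentAt; ring
  rw [e, lt_div_iff₀ hN0']
  rw [div_lt_iff₀ hN0'] at hN
  linarith

lemma tendsto_exponentAt (hζ : 0 < ζ)
    (hlow : ∀ ε > 0, ∃ c > 0, ∀ N : ℕ, c * (ζ * Real.exp (-ε)) ^ N ≤ R N) {C : ℝ} (hC : 0 < C)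
    (hup : ∀ N : ℕ, R N ≤ C * ζ ^ N) : Tendsto (exponentAt R) atTop (𝓝 (-Real.log ζ)) := by
  have hpos : ∀ N, 0 < R N := fun N => by
    obtain ⟨c, hc, H⟩ := hlow 1 one_pos
    exact (H N).trans_lt' (by positivity)
  rw [tendsto_order]
  refine ⟨fun a ha => ?_, fun a ha => ?_⟩
  · simpa using eventually_lt_exponentAt hζ hpos hC hup (sub_pos.2 ha)
  · simpa using eventually_exponentAt_le hζ hlow (sub_pos.2 ha)

lemma riskExponent_le (hζ : 0 < ζ)
    (h : ∀ ε > 0, ∃ c > 0, ∀ N : ℕ, c * (ζ * Real.exp (-ε)) ^ N ≤ R N) :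
    riskExponent R ≤ ((-Real.log ζ : ℝ) : EReal) := by
  refine EReal.le_of_forall_lt_iff_le.1 fun z hz => ?_
  have hz' := sub_pos.2 (EReal.coe_lt_coe_iff.1 hz)
  refine limsup_le_of_le (by isBoundedDefault) ?_
  filter_upwards [eventually_exponentAt_le hζ h hz'] with N hN
  exact EReal.coe_le_coe_iff.2 (by linarith)

lemma riskExponent_eq_of_tendsto {b : ℝ} (h : Tendsto (exponentAt R) atTop (𝓝 b)) :
    riskExponent R = (b : EReal) :=
  ((continuous_coe_real_ereal.tendsto b).comp h).limsup_eq

end Exponents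

/-! ### Risks compared with the overlap of the local decisions. -/

lemma exists_lrtThreshold_eq {cFA cMD l : ℝ} (hFA : 0 < cFA) (hMD : 0 < cMD) (hl : 0 < l) :
    ∃ q ∈ Ioo (0 : ℝ) 1, lrtThreshold cFA cMD q = l := by
  have hd : 0 < cFA + cMD * l := by positivity
  have e : 1 - cMD * l / (cFA + cMD * l) = cFA / (cFA + cMD * l) := by field_simp; ring
  refine ⟨cMD * l / (cFA + cMD * l), ⟨by positivity, ?_⟩, ?_⟩
  · rw [div_lt_one hd]; linarith
  · rw [lrtThreshold, e]; field_simp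

namespace StarModel

variable (M : StarModel)

/-- The sum of the errors of the best decision based on the decisions of local agents. -/
noncomputable def overlap {N : ℕ} (φ : Fin N → ℝ → ℝ) : ℝ :=
  ∑ e : Fin N → Bool, min (∏ i, M.decisionProb (φ i) (e i) false)
    (∏ i, M.decisionProb (φ i) (e i) true)

variable {M}

lemma prod_decisionProb_nonneg {N : ℕ} {φ : Fin N → ℝ → ℝ} (hφ : ∀ i, IsTest (φ i))
    (e : Fin N → Bool) (h : Bool) : 0 ≤ ∏ i, M.decisionProb (φ i) (e i) h :=
  Finset.prod_nonneg fun i _ => M.decisionProb_nonneg (hφ i) _ _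

lemma overlap_eq {N : ℕ} {φ : Fin N → ℝ → ℝ} (hφ : ∀ i, IsTest (φ i)) :
    M.overlap φ = ∑ e : Fin N → Bool, min (∏ i, bern (M.testProb (φ i) false) (e i))
      (∏ i, bern (M.testProb (φ i) true) (e i)) := by
  simp only [overlap, decisionProb_eq_bern (hφ _)]

lemma exists_le_overlap {ζ : ℝ} (hζ : ζ ∈ Ioo (0 : ℝ) 1)
    (hmin : ∀ y ∈ M.testRegion, ∀ t ∈ Icc (0 : ℝ) 1, ζ ≤ affinity t y.1 y.2) {ε : ℝ}
    (hε : 0 < ε) :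
    ∃ c > 0, ∀ (N : ℕ) (φ : Fin N → ℝ → ℝ), (∀ i, IsTest (φ i)) →
      c * (ζ * Real.exp (-ε)) ^ N ≤ M.overlap φ := by
  obtain ⟨c, hc, H⟩ := M.isTestRegion_testRegion.exists_le_sum_min hζ hmin hε
  refine ⟨c, hc, fun N φ hφ => ?_⟩
  rw [overlap_eq hφ]
  exact H N (fun i => (M.testProb (φ i) false, M.testProb (φ i) true))
    fun i => mem_testRegion (hφ i)

lemma risk_eq (cFA cMD π₀ : ℝ) {N : ℕ} (S : DecisionRules N) :
    M.risk cFA cMD π₀ S = ∑ e : Fin N → Bool,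
      (cFA * π₀ * ((∏ i, M.decisionProb (S.localRule i) (e i) false) *
          M.testProb (S.fusionRule e) false) +
        cMD * (1 - π₀) * ((∏ i, M.decisionProb (S.localRule i) (e i) true) *
          (1 - M.testProb (S.fusionRule e) true))) := by
  simp only [risk, fusionProb, Finset.mul_sum, Finset.sum_add_distrib,
    decisionProb_eq_bern (S.isTest_fusion _)]
  simp [bern]

lemma cooperativeError_eq (π₀ : ℝ) {N : ℕ} (S : CooperativeRules N) :
    M.cooperativeError π₀ S = ∑ e : Fin N → Bool,
      (π₀ * ((∏ i, M.decisionProb (S.localRule i) (e i) false) * S.fusionRule e) +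
        (1 - π₀) * ((∏ i, M.decisionProb (S.localRule i) (e i) true) *
          (1 - S.fusionRule e))) := by
  simp [cooperativeError, cooperativeProb, Finset.mul_sum, Finset.sum_add_distrib, bern]

/-- For one vector of local decisions, with likelihoods `P₀`, `P₁`: the fusion agent's conditional
errors `x`, `y` sum to at least `κ`, so it cannot beat the smaller likelihood by more than a
constant. Without a private signal, `κ = 1`. -/
lemma weighted_error_ge {a₀ a₁ P₀ P₁ x y κ : ℝ} (ha₀ : 0 ≤ a₀) (ha₁ : 0 ≤ a₁) (hP₀ : 0 ≤ P₀)
    (hP₁ : 0 ≤ P₁) (hx : 0 ≤ x) (hy : 0 ≤ y) (hxy : κ ≤ x + y) :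
    min a₀ a₁ * κ * min P₀ P₁ ≤ a₀ * (P₀ * x) + a₁ * (P₁ * y) := by
  have h0 : min a₀ a₁ * min P₀ P₁ ≤ a₀ * P₀ :=
    mul_le_mul (min_le_left _ _) (min_le_left _ _) (le_min hP₀ hP₁) ha₀
  have h1 : min a₀ a₁ * min P₀ P₁ ≤ a₁ * P₁ :=
    mul_le_mul (min_le_right _ _) (min_le_right _ _) (le_min hP₀ hP₁) ha₁
  have h2 : 0 ≤ min a₀ a₁ * min P₀ P₁ := mul_nonneg (le_min ha₀ ha₁) (le_min hP₀ hP₁)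
  nlinarith [mul_le_mul_of_nonneg_right h0 hx, mul_le_mul_of_nonneg_right h1 hy,
    mul_le_mul_of_nonneg_left hxy h2]

lemma exists_le_risk {cFA cMD π₀ : ℝ} (hFA : 0 < cFA) (hMD : 0 < cMD)
    (hπ : π₀ ∈ Ioo (0 : ℝ) 1) {ζ : ℝ} (hζ : ζ ∈ Ioo (0 : ℝ) 1)
    (hmin : ∀ y ∈ M.testRegion, ∀ t ∈ Icc (0 : ℝ) 1, ζ ≤ affinity t y.1 y.2) {ε : ℝ}
    (hε : 0 < ε) :
    ∃ c > 0, ∀ (N : ℕ) (S : DecisionRules N),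
      c * (ζ * Real.exp (-ε)) ^ N ≤ M.risk cFA cMD π₀ S := by
  obtain ⟨c, hc, H⟩ := exists_le_overlap hζ hmin hε
  obtain ⟨κ, hκ, Hκ⟩ := M.exists_le_testProb_add
  have h0 : 0 < cFA * π₀ := mul_pos hFA hπ.1
  have h1 : 0 < cMD * (1 - π₀) := mul_pos hMD (sub_pos.2 hπ.2)
  refine ⟨min (cFA * π₀) (cMD * (1 - π₀)) * κ * c, by positivity, fun N S => ?_⟩
  rw [mul_assoc]
  refine (mul_le_mul_of_nonneg_left (H N S.localRule S.isTest_local) (by positivity)).trans ?_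
  rw [risk_eq, overlap, Finset.mul_sum]
  refine Finset.sum_le_sum fun e _ => weighted_error_ge h0.le h1.le
    (prod_decisionProb_nonneg S.isTest_local _ _) (prod_decisionProb_nonneg S.isTest_local _ _)
    ?_ ?_ (Hκ _ (S.isTest_fusion e))
  · exact ((S.isTest_fusion e).integral_mem_Icc _).1
  · exact sub_nonneg.2 ((S.isTest_fusion e).integral_mem_Icc _).2

lemma exists_le_cooperativeError {π₀ : ℝ} (hπ : π₀ ∈ Ioo (0 : ℝ) 1) {ζ : ℝ}
    (hζ : ζ ∈ Ioo (0 : ℝ) 1)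
    (hmin : ∀ y ∈ M.testRegion, ∀ t ∈ Icc (0 : ℝ) 1, ζ ≤ affinity t y.1 y.2) {ε : ℝ}
    (hε : 0 < ε) :
    ∃ c > 0, ∀ (N : ℕ) (S : CooperativeRules N),
      c * (ζ * Real.exp (-ε)) ^ N ≤ M.cooperativeError π₀ S := by
  obtain ⟨c, hc, H⟩ := exists_le_overlap hζ hmin hε
  have h0 : 0 < π₀ := hπ.1
  have h1 : 0 < 1 - π₀ := sub_pos.2 hπ.2
  refine ⟨min π₀ (1 - π₀) * 1 * c, by positivity, fun N S => ?_⟩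
  rw [mul_assoc]
  refine (mul_le_mul_of_nonneg_left (H N S.localRule S.isTest_local) (by positivity)).trans ?_
  rw [cooperativeError_eq, overlap, Finset.mul_sum]
  exact Finset.sum_le_sum fun e _ => weighted_error_ge h0.le h1.le
    (prod_decisionProb_nonneg S.isTest_local _ _) (prod_decisionProb_nonneg S.isTest_local _ _)
    (S.fusion_mem e).1 (sub_nonneg.2 (S.fusion_mem e).2) (by linarith)

lemma overlap_const_le {φ : ℝ → ℝ} (hφ : IsTest φ) {s : ℝ} (hs : s ∈ Icc (0 : ℝ) 1) (N : ℕ) :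
    M.overlap (fun _ : Fin N => φ) ≤
      affinity s (M.testProb φ false) (M.testProb φ true) ^ N := by
  rw [overlap_eq fun _ => hφ]
  exact sum_min_le_affinity_pow hs (hφ.integral_mem_Icc _) (hφ.integral_mem_Icc _) N

variable (M)

/-- All agents use the test `φ`, and the fusion agent decides by maximum likelihood. -/
noncomputable def maxLikelihoodRules {φ : ℝ → ℝ} (hφ : IsTest φ) (N : ℕ) : CooperativeRules N where
  localRule _ := φ
  fusionRule e := by
    classical exact
    if ∏ i, M.decisionProb φ (e i) false ≤ ∏ i, M.decisionProb φ (e i) true then 1 else 0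
  isTest_local _ := hφ
  fusion_mem e := by split_ifs <;> simp

lemma cooperativeError_maxLikelihoodRules_le {π₀ : ℝ} (hπ : π₀ ∈ Ioo (0 : ℝ) 1) {φ : ℝ → ℝ}
    (hφ : IsTest φ) (N : ℕ) :
    M.cooperativeError π₀ (M.maxLikelihoodRules hφ N) ≤ M.overlap fun _ : Fin N => φ := by
  rw [cooperativeError_eq, overlap]
  refine Finset.sum_le_sum fun e _ => ?_
  have h0 : 0 ≤ ∏ i, M.decisionProb φ (e i) false := prod_decisionProb_nonneg (fun _ => hφ) _ _
  have h1 : 0 ≤ ∏ i, M.decisionProb φ (e i) true := prod_decisionProb_nonneg (fun _ => hφ) _ _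
  simp only [maxLikelihoodRules]
  split_ifs with h
  · rw [min_eq_left h]
    nlinarith [hπ.2]
  · rw [min_eq_right (not_le.1 h).le]
    nlinarith [hπ.1]

/-- The threshold is proportional to the odds of the belief, so the update multiplies it by the
likelihood ratio of the local decisions. -/
lemma lrtThreshold_updatedBelief (T : TieRule) (cFA cMD : ℝ) {q : ℝ} (hq : q ∈ Ioo (0 : ℝ) 1)
    {N : ℕ} (e : Fin N → Bool) :
    lrtThreshold cFA cMD (M.updatedBelief T cFA cMD q e) = lrtThreshold cFA cMD q *
      ((∏ i, M.localProb T cFA cMD q (e i) false) /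
        ∏ i, M.localProb T cFA cMD q (e i) true) := by
  have h := M.updatedBelief_odds T cFA cMD hq e
  rw [Finset.prod_div_distrib] at h
  rw [lrtThreshold, lrtThreshold, mul_div_mul_comm, h, mul_div_mul_comm, mul_assoc]

lemma localProb_true (T : TieRule) (cFA cMD q : ℝ) (h : Bool) :
    M.localProb T cFA cMD q true h = M.testProb (M.beliefTest T cFA cMD q) h := by
  simp [localProb, decisionProb, testProb]

/-- The wrong prior in the belief update costs at most a constant factor. -/
lemma risk_beliefRules_le (T : TieRule) {cFA cMD π₀ q : ℝ} (hFA : 0 < cFA) (hMD : 0 < cMD)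
    (hπ : π₀ ∈ Ioo (0 : ℝ) 1) (hq : q ∈ Ioo (0 : ℝ) 1)
    (hpos : ∀ d h, 0 < M.localProb T cFA cMD q d h) (N : ℕ) :
    M.risk cFA cMD π₀ (M.beliefRules T cFA cMD q fun _ : Fin N => q) ≤
      (cFA * (1 + (lrtThreshold cFA cMD q)⁻¹) + cMD * (1 + lrtThreshold cFA cMD q)) *
        M.overlap fun _ : Fin N => M.beliefTest T cFA cMD q := by
  rw [risk_eq, overlap, Finset.mul_sum]
  refine Finset.sum_le_sum fun e _ => ?_
  have hl : 0 < lrtThreshold cFA cMD q :=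
    div_pos (mul_pos hFA hq.1) (mul_pos hMD (sub_pos.2 hq.2))
  simp only [beliefRules, beliefTest]
  rw [lrtThreshold_updatedBelief M T cFA cMD hq]
  change _ ≤ _ * min (∏ i, M.localProb T cFA cMD q (e i) false)
    (∏ i, M.localProb T cFA cMD q (e i) true)
  change cFA * π₀ * ((∏ i, M.localProb T cFA cMD q (e i) false) * _) +
    cMD * (1 - π₀) * ((∏ i, M.localProb T cFA cMD q (e i) true) * _) ≤ _
  have ha : 0 < ∏ i, M.localProb T cFA cMD q (e i) false := Finset.prod_pos fun i _ => hpos _ _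
  have hb : 0 < ∏ i, M.localProb T cFA cMD q (e i) true := Finset.prod_pos fun i _ => hpos _ _
  set a := ∏ i, M.localProb T cFA cMD q (e i) false
  set b := ∏ i, M.localProb T cFA cMD q (e i) true
  set l := lrtThreshold cFA cMD q
  have hτ : 0 < l * (a / b) := by positivity
  have hI := M.isTestRegion_testRegion.mem_Icc _ (mem_testRegion (M.isTest_lrt T (l * (a / b))))
  have h1 := M.mul_testProb_lrt_le T (l * (a / b))
  have h2 := M.one_sub_testProb_lrt_le T hτ
  set x := M.testProb (M.lrt T (l * (a / b))) false
  set y := M.testProb (M.lrt T (l * (a / b))) true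
  have hx0 : 0 ≤ x := hI.1.1
  have hx1 : x ≤ 1 := hI.1.2
  have hy0 : 0 ≤ y := hI.2.1
  have hy1 : y ≤ 1 := hI.2.2
  have hm : 0 < min a b := lt_min ha hb
  -- If `a` is the smaller likelihood, `x ≤ 1` suffices; otherwise Markov's bound `l * (a / b) * x ≤
  -- 1` trades `a` for `b`. The bound `k2` is symmetric.
  have k1 : a * x ≤ (1 + l⁻¹) * min a b := by
    rcases le_total a b with h | h
    · rw [min_eq_left h]
      have : 0 ≤ l⁻¹ * a := by positivity
      nlinarith
    · rw [min_eq_right h]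
      have : a * x ≤ l⁻¹ * b := by
        rw [inv_mul_eq_div, le_div_iff₀ hl]
        calc a * x * l = l * (a / b) * x * b := by field_simp
          _ ≤ 1 * b := by gcongr
          _ = b := one_mul b
      linarith
  have k2 : b * (1 - y) ≤ (1 + l) * min a b := by
    rcases le_total a b with h | h
    · rw [min_eq_left h]
      have : b * (1 - y) ≤ l * a := by
        calc b * (1 - y) ≤ b * (l * (a / b)) := by gcongr
          _ = l * a := by field_simp
      linarith
    · rw [min_eq_right h]
      have : 0 ≤ l * b := by positivity
      nlinarith
  have k3 : cFA * π₀ * (a * x) ≤ cFA * ((1 + l⁻¹) * min a b) := by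
    rw [mul_assoc]
    refine mul_le_mul_of_nonneg_left ?_ hFA.le
    exact (mul_le_of_le_one_left (by positivity) hπ.2.le).trans k1
  have k4 : cMD * (1 - π₀) * (b * (1 - y)) ≤ cMD * ((1 + l) * min a b) := by
    rw [mul_assoc]
    refine mul_le_mul_of_nonneg_left ?_ hMD.le
    exact (mul_le_of_le_one_left (mul_nonneg hb.le (sub_nonneg.2 hy1))
      (by linarith [hπ.1])).trans k2
  linarith

end StarModel

/-! ### The optimal belief. -/

/-- The conclusions hold for every tie rule, and sub-Gaussianity is not needed. -/
theorem StarModel.exists_optimal_belief (M : StarModel) {cFA cMD : ℝ} (hFA : 0 < cFA)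
    (hMD : 0 < cMD) (T : TieRule) :
    ∃ q ∈ Ioo (0 : ℝ) 1, ∃ β : ℝ,
      IsGreatest ((fun q₁ : ℝ =>
          chernoffInfo (bern (M.localProb T cFA cMD q₁ true false))
            (bern (M.localProb T cFA cMD q₁ true true))) '' Ioo (0 : ℝ) 1) β ∧
      ∀ π₀ ∈ Ioo (0 : ℝ) 1,
        Tendsto (exponentAt fun N =>
            M.risk cFA cMD π₀ (M.beliefRules T cFA cMD q (fun _ : Fin N => q)))
          atTop (𝓝 β) ∧
        M.optimalExponent cFA cMD π₀ = (β : EReal) ∧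
        M.cooperativeExponent π₀ = (β : EReal) := by
  have hK := M.isTestRegion_testRegion
  obtain ⟨x₀, hx₀, hne⟩ := M.exists_testRegion_ne
  obtain ⟨ζ, hζ, s, hs, hmin, l, hl, hopt⟩ := hK.exists_slope_min hx₀ hne
  have hsI := Ioo_subset_Icc_self hs
  obtain ⟨q, hq, hql⟩ := exists_lrtThreshold_eq hFA hMD hl
  have hψ : IsTest (M.beliefTest T cFA cMD q) := M.isTest_lrt T _
  set ψ := M.beliefTest T cFA cMD q with hψdef
  have hψK := mem_testRegion (M := M) hψ
  have haff : affinity s (M.testProb ψ false) (M.testProb ψ true) ≤ ζ := by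
    refine hopt _ hψK ?_
    rintro _ ⟨φ, hφ, rfl⟩
    simp only [hψdef, StarModel.beliefTest, hql]
    exact M.lrt_optimal T l hφ
  -- An affinity below `1` shows that the test is informative; its probabilities then lie strictly
  -- between `0` and `1`, and no factor `0 / 0` occurs in the belief update.
  have hpq : M.testProb ψ false ≠ M.testProb ψ true := fun h => by
    rw [← h, affinity_self (hK.mem_Icc _ hψK).1] at haff
    exact absurd hζ.2 (not_lt.2 haff)
  have hψI := hK.mem_Ioo_of_ne hψK hpq
  have hpos : ∀ d h, 0 < M.localProb T cFA cMD q d h := fun d h => by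
    rw [StarModel.localProb, decisionProb_eq_bern hψ]
    cases d <;> cases h <;> simp only [bern]
    · simpa using hψI.1.2
    · simpa using hψI.2.2
    · simpa using hψI.1.1
    · simpa using hψI.2.1
  have haff0 : 0 ≤ affinity s (M.testProb ψ false) (M.testProb ψ true) :=
    (hK.affinity_pos hψK hsI).le
  have hover : ∀ N : ℕ, M.overlap (fun _ : Fin N => ψ) ≤ ζ ^ N := fun N =>
    (overlap_const_le hψ hsI N).trans (pow_le_pow_left₀ haff0 haff N)
  have hl' : 0 < lrtThreshold cFA cMD q := hql ▸ hl
  refine ⟨q, hq, -Real.log ζ, ⟨⟨q, hq, ?_⟩, ?_⟩, fun π₀ hπ => ?_⟩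
  · simp only [StarModel.localProb_true]
    have h1 := IsTestRegion.chernoffInfo_le hζ.1 hmin hψK
    have h2 := IsTestRegion.neg_log_affinity_le_chernoffInfo hζ.1 hmin hψK hsI
    have h3 := Real.log_le_log (hK.affinity_pos hψK hsI) haff
    exact le_antisymm h1 (h2.trans' (neg_le_neg h3))
  · rintro _ ⟨q₁, -, rfl⟩
    simp only [StarModel.localProb_true]
    have hψ₁ : IsTest (M.beliefTest T cFA cMD q₁) := M.isTest_lrt T _
    have h1 := IsTestRegion.chernoffInfo_le hζ.1 hmin (mem_testRegion hψ₁)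
    exact h1
  have hlow : ∀ S : (N : ℕ) → DecisionRules N, ∀ ε > 0, ∃ c > 0, ∀ N : ℕ,
      c * (ζ * Real.exp (-ε)) ^ N ≤ M.risk cFA cMD π₀ (S N) := fun S ε hε => by
    obtain ⟨c, hc, H⟩ := StarModel.exists_le_risk hFA hMD hπ hζ hmin hε
    exact ⟨c, hc, fun N => H N (S N)⟩
  have hlow' : ∀ S : (N : ℕ) → CooperativeRules N, ∀ ε > 0, ∃ c > 0, ∀ N : ℕ,
      c * (ζ * Real.exp (-ε)) ^ N ≤ M.cooperativeError π₀ (S N) := fun S ε hε => by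
    obtain ⟨c, hc, H⟩ := StarModel.exists_le_cooperativeError hπ hζ hmin hε
    exact ⟨c, hc, fun N => H N (S N)⟩
  have htend := tendsto_exponentAt hζ.1
    (hlow fun N => M.beliefRules T cFA cMD q fun _ : Fin N => q)
    (C := cFA * (1 + (lrtThreshold cFA cMD q)⁻¹) + cMD * (1 + lrtThreshold cFA cMD q))
    (by positivity) fun N => (M.risk_beliefRules_le T hFA hMD hπ hq hpos N).trans
      (mul_le_mul_of_nonneg_left (hover N) (by positivity))
  have htend' := tendsto_exponentAt hζ.1 (hlow' fun N => M.maxLikelihoodRules hψ N) one_pos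
    fun N => ((M.cooperativeError_maxLikelihoodRules_le hπ hψ N).trans (hover N)).trans
      (one_mul _).ge
  refine ⟨htend, le_antisymm (iSup_le fun S => riskExponent_le hζ.1 (hlow S)) ?_,
    le_antisymm (iSup_le fun S => riskExponent_le hζ.1 (hlow' S)) ?_⟩
  · rw [← riskExponent_eq_of_tendsto htend]
    exact le_iSup (fun S : (N : ℕ) → DecisionRules N =>
      riskExponent fun N => M.risk cFA cMD π₀ (S N))
      fun N => M.beliefRules T cFA cMD q fun _ : Fin N => q
  · rw [← riskExponent_eq_of_tendsto htend']
    exact le_iSup (fun S : (N : ℕ) → CooperativeRules N =>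
      riskExponent fun N => M.cooperativeError π₀ (S N)) fun N => M.maxLikelihoodRules hψ N

theorem mainTheorem1 (M : StarModel) (hsub : M.SubGaussian)
    (cFA cMD : ℝ) (hFA : 0 < cFA) (hMD : 0 < cMD) :
    ∃ T₀ : TieRule, ∀ T : TieRule, (T = T₀ ∨ M.TiesNull) →
      ∃ q ∈ Ioo (0 : ℝ) 1, ∃ β : ℝ,
        IsGreatest ((fun q₁ : ℝ =>
            chernoffInfo (bern (M.localProb T cFA cMD q₁ true false))
              (bern (M.localProb T cFA cMD q₁ true true))) '' Ioo (0 : ℝ) 1) β ∧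
        ∀ π₀ ∈ Ioo (0 : ℝ) 1,
          Tendsto (exponentAt fun N =>
              M.risk cFA cMD π₀ (M.beliefRules T cFA cMD q (fun _ : Fin N => q)))
            atTop (𝓝 β) ∧
          M.optimalExponent cFA cMD π₀ = (β : EReal) ∧
          M.cooperativeExponent π₀ = (β : EReal) := by
  exact ⟨⟨∅, MeasurableSet.empty⟩, fun T _ => M.exists_optimal_belief hFA hMD T⟩
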